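/- Let $p,q\in\mathbb C$ with $|p|<1$, $q\neq 0$, and write $$\theta(z)=\prod_{j=0}^\infty(1-p^jz)(1-p^{j+1}/z),\qquad (z)_k=\theta(z)\theta(qz)\cdots\theta(q^{k-1}z)\quad(k\ge 0),$$ $(z_1,\dots,z_m)_k=(z_1)_k\cdots(z_m)_k$. For $z=(z_1,\dots,z_n)$ and $x=(x_1,\dots,x_n)$ write $|x|=x_1+\dots+x_n$, $Z=z_1\cdots z_n$ and $$\frac{\Delta(zq^x)}{\Delta(z)}=\prod_{1\le i<j\le n}\frac{q^{x_i}\theta(q^{x_j-x_i}z_j/z_i)}{\theta(z_j/z_i)}.$$ Let $N\ge 0$ be an integer and let $a,b,c,d,e,z_1,\dots,z_n$ be nonzero complex numbers such that $$a^2q^{N+1}=bcde\,z_1^2\cdots z_n^2$$ and such that no theta factor in a denominator below vanishes. Then $$\sum_{\substack{x_1,\dots,x_n\ge 0\\ x_1+\dots+x_n\le N}}\frac{\Delta(zq^x)}{\Delta(z)}\,\frac{\theta(aq^{2|x|})}{\theta(a)}\,\frac{\prod_{1\le i<j\le n}(z_iz_j)_{x_i+x_j}}{\prod_{i=1}^n(e/z_i)_{|x|-x_i}}\,\frac{(a,q^{-N})_{|x|}\prod_{i=1}^n(e/z_i)_{|x|}}{(aq^{N+1})_{|x|}}\,q^{|x|}$$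 $$\times\prod_{i=1}^n\frac{(bz_i,cz_i,dz_i,q^{-N}ez_i/a)_{x_i}}{(aqz_i/e)_{x_i}\prod_{j=1}^n(qz_i/z_j)_{x_i}}\cdot\begin{cases}\dfrac1{(q^{-N}eZ/a,\,aq/bZ,\,aq/cZ,\,aq/dZ)_{|x|}},& n\text{ odd},\\[3mm]\dfrac1{(aq/Z,\,aq/bcZ,\,aq/bdZ,\,aq/cdZ)_{|x|}},& n\text{ even}\end{cases}$$ $$=\frac{(aq,aq/be,aq/ce,aq/de)_N\prod_{i=1}^n(aq/ez_i)_N}{Z^N\prod_{i=1}^n(aqz_i/e)_N}\cdot\begin{cases}\dfrac{e^N}{(aq/bZ,\,aq/cZ,\,aq/dZ,\,aq/eZ)_N},& n\text{ odd},\\[3mm]\dfrac1{(aq/Z,\,aq/beZ,\,aq/ceZ,\,aq/deZ)_N},& n\text{ even}.\end{cases}$$ Here $aq/bZ$ means $aq/(bZ)$, and similarly for the other quotients. -/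

import Mathlib

open Finset

/-- The theta function `θ(z) = ∏_{j ≥ 0} (1 - p^j z) (1 - p^{j+1} / z)` of nome `p`. -/
noncomputable def ellTheta (p z : ℂ) : ℂ :=
  ∏' j : ℕ, (1 - p ^ j * z) * (1 - p ^ (j + 1) / z)

/-- The infinite product defining `ellTheta` converges (unconditionally) for `|p| < 1`. -/
theorem hasProd_ellTheta {p : ℂ} (hp : ‖p‖ < 1) (z : ℂ) :
    HasProd (fun j : ℕ => (1 - p ^ j * z) * (1 - p ^ (j + 1) / z)) (ellTheta p z) := by
  have hg : Summable fun j : ℕ => ‖p‖ ^ j := summable_geometric_of_lt_one (norm_nonneg p) hp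
  have h1 : Multipliable fun j : ℕ => 1 - p ^ j * z := by
    simp only [sub_eq_add_neg]
    refine multipliable_one_add_of_summable ?_
    simpa only [norm_neg, norm_mul, norm_pow] using hg.mul_right ‖z‖
  have h2 : Multipliable fun j : ℕ => 1 - p ^ (j + 1) / z := by
    simp only [sub_eq_add_neg]
    refine multipliable_one_add_of_summable ?_
    simpa only [norm_neg, norm_div, norm_pow] using
      ((summable_nat_add_iff 1).2 hg).div_const ‖z‖
  exact (h1.mul h2).hasProd

/-- The elliptic shifted factorial `(z)_k = θ(z) θ(qz) ⋯ θ(q^{k-1} z)` for `k ≥ 0`. -/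
noncomputable def ellPoch (p q z : ℂ) (k : ℕ) : ℂ :=
  ∏ j ∈ range k, ellTheta p (q ^ j * z)

/-- The quotient
`Δ(z q^x) / Δ(z) = ∏_{i < j} q^{x_i} θ(q^{x_j - x_i} z_j / z_i) / θ(z_j / z_i)`. -/
noncomputable def ellDelta (p q : ℂ) {n : ℕ} (z : Fin n → ℂ) (x : Fin n → ℕ) : ℂ :=
  ∏ i, ∏ j ∈ Ioi i,
    q ^ x i * ellTheta p (q ^ ((x j : ℤ) - (x i : ℤ)) * (z j / z i)) / ellTheta p (z j / z i)

/-- The set of multi-indices `x = (x_1, …, x_n)` of natural numbers with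
`x_1 + ⋯ + x_n ≤ N`. -/
def indexSimplex (n N : ℕ) : Finset (Fin n → ℕ) :=
  (Fintype.piFinset fun _ : Fin n => range (N + 1)).filter fun x => ∑ i, x i ≤ N

theorem mem_indexSimplex {n N : ℕ} {x : Fin n → ℕ} :
    x ∈ indexSimplex n N ↔ ∑ i, x i ≤ N := by
  simp only [indexSimplex, mem_filter, Fintype.mem_piFinset, mem_range, and_iff_right_iff_imp]
  intro h i
  exact Nat.lt_succ_of_le ((single_le_sum (fun j _ => Nat.zero_le (x j)) (mem_univ i)).trans h)

/-- The factor of the summand depending on the parity of `n`; here `Z = z_1 ⋯ z_n` and `k = |x|`.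
It is `1 / (q^{-N} e Z / a, aq / bZ, aq / cZ, aq / dZ)_k` for odd `n` and
`1 / (aq / Z, aq / bcZ, aq / bdZ, aq / cdZ)_k` for even `n`. -/
noncomputable def paritySummandFactor (p q a b c d e Z : ℂ) (n N k : ℕ) : ℂ :=
  if Odd n then
    1 / (ellPoch p q (q ^ (-(N : ℤ)) * e * Z / a) k * ellPoch p q (a * q / (b * Z)) k *
      ellPoch p q (a * q / (c * Z)) k * ellPoch p q (a * q / (d * Z)) k)
  else
    1 / (ellPoch p q (a * q / Z) k * ellPoch p q (a * q / (b * c * Z)) k *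
      ellPoch p q (a * q / (b * d * Z)) k * ellPoch p q (a * q / (c * d * Z)) k)

/-- The summand. Note that `|x| - x_i` is never truncated, as `x_i ≤ |x|`. -/
noncomputable def jacksonSummand (p q a b c d e : ℂ) {n : ℕ} (z : Fin n → ℂ) (N : ℕ)
    (x : Fin n → ℕ) : ℂ :=
  ellDelta p q z x *
  (ellTheta p (a * q ^ (2 * ∑ i, x i)) / ellTheta p a) *
  ((∏ i, ∏ j ∈ Ioi i, ellPoch p q (z i * z j) (x i + x j)) /
    ∏ i, ellPoch p q (e / z i) ((∑ j, x j) - x i)) *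
  ((ellPoch p q a (∑ i, x i) * ellPoch p q (q ^ (-(N : ℤ))) (∑ i, x i) *
      ∏ i, ellPoch p q (e / z i) (∑ j, x j)) /
    ellPoch p q (a * q ^ (N + 1)) (∑ i, x i)) *
  q ^ (∑ i, x i) *
  (∏ i, (ellPoch p q (b * z i) (x i) * ellPoch p q (c * z i) (x i) *
      ellPoch p q (d * z i) (x i) * ellPoch p q (q ^ (-(N : ℤ)) * e * z i / a) (x i)) /
    (ellPoch p q (a * q * z i / e) (x i) * ∏ j, ellPoch p q (q * z i / z j) (x i))) *
  paritySummandFactor p q a b c d e (∏ i, z i) n N (∑ i, x i)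

/-- The factor of the closed form depending on the parity of `n`; here `Z = z_1 ⋯ z_n`.
It is `e^N / (aq / bZ, aq / cZ, aq / dZ, aq / eZ)_N` for odd `n` and
`1 / (aq / Z, aq / beZ, aq / ceZ, aq / deZ)_N` for even `n`. -/
noncomputable def parityValueFactor (p q a b c d e Z : ℂ) (n N : ℕ) : ℂ :=
  if Odd n then
    e ^ N / (ellPoch p q (a * q / (b * Z)) N * ellPoch p q (a * q / (c * Z)) N *
      ellPoch p q (a * q / (d * Z)) N * ellPoch p q (a * q / (e * Z)) N)
  else
    1 / (ellPoch p q (a * q / Z) N * ellPoch p q (a * q / (b * e * Z)) N *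
      ellPoch p q (a * q / (c * e * Z)) N * ellPoch p q (a * q / (d * e * Z)) N)

/-- The closed form of the sum. -/
noncomputable def jacksonValue (p q a b c d e : ℂ) {n : ℕ} (z : Fin n → ℂ) (N : ℕ) : ℂ :=
  (ellPoch p q (a * q) N * ellPoch p q (a * q / (b * e)) N * ellPoch p q (a * q / (c * e)) N *
      ellPoch p q (a * q / (d * e)) N * ∏ i, ellPoch p q (a * q / (e * z i)) N) /
    ((∏ i, z i) ^ N * ∏ i, ellPoch p q (a * q * z i / e) N) *
  parityValueFactor p q a b c d e (∏ i, z i) n N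

/-- No theta factor in a denominator of the summands or of the closed form vanishes. -/
structure JacksonDenominatorsNeZero (p q a b c d e : ℂ) {n : ℕ} (z : Fin n → ℂ) (N : ℕ) :
    Prop where
  delta : ∀ i j : Fin n, i < j → ellTheta p (z j / z i) ≠ 0
  theta_a : ellTheta p a ≠ 0
  e_div : ∀ x ∈ indexSimplex n N, ∀ i, ellPoch p q (e / z i) ((∑ j, x j) - x i) ≠ 0
  aq_pow : ∀ k ≤ N, ellPoch p q (a * q ^ (N + 1)) k ≠ 0
  aq_div_e : ∀ i, ∀ k ≤ N, ellPoch p q (a * q * z i / e) k ≠ 0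
  q_div : ∀ i j, ∀ k ≤ N, ellPoch p q (q * z i / z j) k ≠ 0
  odd_summand : Odd n → ∀ k ≤ N,
    ellPoch p q (q ^ (-(N : ℤ)) * e * (∏ i, z i) / a) k ≠ 0 ∧
    ellPoch p q (a * q / (b * ∏ i, z i)) k ≠ 0 ∧
    ellPoch p q (a * q / (c * ∏ i, z i)) k ≠ 0 ∧
    ellPoch p q (a * q / (d * ∏ i, z i)) k ≠ 0
  even_summand : Even n → ∀ k ≤ N,
    ellPoch p q (a * q / ∏ i, z i) k ≠ 0 ∧
    ellPoch p q (a * q / (b * c * ∏ i, z i)) k ≠ 0 ∧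
    ellPoch p q (a * q / (b * d * ∏ i, z i)) k ≠ 0 ∧
    ellPoch p q (a * q / (c * d * ∏ i, z i)) k ≠ 0
  odd_value : Odd n → ellPoch p q (a * q / (e * ∏ i, z i)) N ≠ 0
  even_value : Even n →
    ellPoch p q (a * q / (b * e * ∏ i, z i)) N ≠ 0 ∧
    ellPoch p q (a * q / (c * e * ∏ i, z i)) N ≠ 0 ∧
    ellPoch p q (a * q / (d * e * ∏ i, z i)) N ≠ 0

/- Fix `a q^N` and `e q^N`, and multiply the summand for `N + 1` by `1`, written as the sum of a
type `A` partial fraction expansion. One of its terms vanishes at `|x| = N + 1`; the others belong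
to the nodes `z_l q^{x_l}` and vanish at `x_l = 0`, so that `x` may be replaced by `x + e_l` in
them. In this way the sum for `N + 1` becomes a sum over `|x| ≤ N`, in which the coefficient of the
summand for `N` is a partial fraction sum of type `D`. The latter evaluates to a quotient
independent of `x`, namely that of the closed forms for `N + 1` and `N`. Both partial fraction
identities rest on the three-term relation for `θ`, which holds because `θ(xy) θ(x/y)` has rank two.

The recursion meets denominators which may vanish although those of the theorem do not; the
general case follows by continuity, on varying the parameters within the balancing condition. -/

/-! ### Theta functions -/

/-- The `q`-Pochhammer symbol `(z; p)_∞ = ∏_{j ≥ 0} (1 - p^j z)`; thus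
`θ(z) = (z; p)_∞ (p/z; p)_∞`. -/
noncomputable def pochInf (p z : ℂ) : ℂ := ∏' j : ℕ, (1 - p ^ j * z)

section Theta

open Filter Topology

variable {p : ℂ}

theorem summable_norm_pow_mul (hp : ‖p‖ < 1) (z : ℂ) :
    Summable fun j : ℕ => ‖-(p ^ j * z)‖ := by
  simpa only [norm_neg, norm_mul, norm_pow] using
    (summable_geometric_of_lt_one (norm_nonneg p) hp).mul_right ‖z‖

theorem multipliable_one_sub_pow_mul (hp : ‖p‖ < 1) (z : ℂ) :
    Multipliable fun j : ℕ => 1 - p ^ j * z := by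
  simpa only [sub_eq_add_neg] using multipliable_one_add_of_summable (summable_norm_pow_mul hp z)

theorem pochInf_eq_prod_mul (hp : ‖p‖ < 1) (z : ℂ) (n : ℕ) :
    pochInf p z = (∏ j ∈ range n, (1 - p ^ j * z)) * pochInf p (p ^ n * z) := by
  have hshift (j : ℕ) : 1 - p ^ j * (p ^ n * z) = 1 - p ^ (j + n) * z := by rw [pow_add, mul_assoc]
  simp only [pochInf, hshift]
  refine (Multipliable.prod_mul_tprod_nat_mul' (f := fun j => 1 - p ^ j * z) ?_).symm
  exact (multipliable_one_sub_pow_mul hp (p ^ n * z)).congr fun j => hshift j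

theorem pochInf_eq_one_sub_mul (hp : ‖p‖ < 1) (z : ℂ) :
    pochInf p z = (1 - z) * pochInf p (p * z) := by
  simpa using pochInf_eq_prod_mul hp z 1

theorem pochInf_eq_zero_iff (hp : ‖p‖ < 1) {z : ℂ} :
    pochInf p z = 0 ↔ ∃ j : ℕ, p ^ j * z = 1 := by
  refine ⟨fun h => ?_, fun ⟨j, hj⟩ => tprod_of_exists_eq_zero ⟨j, sub_eq_zero.2 hj.symm⟩⟩
  by_contra! hz
  refine tprod_one_add_ne_zero_of_summable (fun j => ?_) (summable_norm_pow_mul hp z)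
    (by simpa only [pochInf, sub_eq_add_neg] using h)
  rw [← sub_eq_add_neg]
  exact sub_ne_zero.2 (hz j).symm

theorem continuous_pochInf (hp : ‖p‖ < 1) : Continuous (pochInf p) := by
  refine continuous_iff_continuousAt.2 fun z => ?_
  have hbound : ∀ᶠ w in 𝓝 z, ∀ j : ℕ, ‖-(p ^ j * w)‖ ≤ ‖p‖ ^ j * (‖z‖ + 1) := by
    filter_upwards [continuous_norm.continuousAt.eventually_le_const (lt_add_one ‖z‖)] with w hw j
    rw [norm_neg, norm_mul, norm_pow]
    gcongr
  have hlim := tendsto_tprod_one_add_of_dominated_convergence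
    ((summable_geometric_of_lt_one (norm_nonneg p) hp).mul_right (‖z‖ + 1))
    (fun j => (by fun_prop : Continuous fun w : ℂ => -(p ^ j * w)).tendsto z) hbound
  simp only [← sub_eq_add_neg] at hlim
  exact hlim

theorem eq_mul_pochInf (hp : ‖p‖ < 1) {f : ℂ → ℂ} (hf : ContinuousAt f 0)
    (hfz : ∀ z, f z = (1 - z) * f (p * z)) (z : ℂ) : f z = f 0 * pochInf p z := by
  have hprod (n : ℕ) : f z = f (p ^ n * z) * ∏ j ∈ range n, (1 - p ^ j * z) := by
    induction n with
    | zero => simp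
    | succ n ih => rw [ih, hfz (p ^ n * z), prod_range_succ, pow_succ']; ring_nf
  have hpow : Tendsto (fun n : ℕ => p ^ n * z) atTop (𝓝 0) := by
    simpa using (tendsto_pow_atTop_nhds_zero_of_norm_lt_one hp).mul_const z
  refine tendsto_nhds_unique (tendsto_const_nhds.congr hprod)
    ((hf.tendsto.comp hpow).mul (multipliable_one_sub_pow_mul hp z).hasProd.tendsto_prod_nat)

theorem ellTheta_eq_pochInf (hp : ‖p‖ < 1) (z : ℂ) :
    ellTheta p z = pochInf p z * pochInf p (p / z) := by
  rw [pochInf, pochInf, ← (multipliable_one_sub_pow_mul hp z).tprod_mul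
    (multipliable_one_sub_pow_mul hp (p / z)), ellTheta]
  simp only [pow_succ, mul_div_assoc]

theorem continuousAt_ellTheta (hp : ‖p‖ < 1) {z : ℂ} (hz : z ≠ 0) :
    ContinuousAt (ellTheta p) z := by
  rw [funext (ellTheta_eq_pochInf hp)]
  exact (continuous_pochInf hp).continuousAt.mul
    ((continuous_pochInf hp).continuousAt.comp (continuousAt_const.div continuousAt_id hz))

theorem ellTheta_inv (hp : ‖p‖ < 1) {z : ℂ} (hz : z ≠ 0) :
    ellTheta p z⁻¹ * z = -ellTheta p z := by
  rw [ellTheta_eq_pochInf hp, ellTheta_eq_pochInf hp, pochInf_eq_one_sub_mul hp z,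
    pochInf_eq_one_sub_mul hp z⁻¹, div_inv_eq_mul, ← div_eq_mul_inv]
  field_simp
  ring

theorem ellTheta_inv_ne_zero (hp : ‖p‖ < 1) {z : ℂ} (hz : z ≠ 0) (h : ellTheta p z ≠ 0) :
    ellTheta p z⁻¹ ≠ 0 :=
  left_ne_zero_of_mul ((ellTheta_inv hp hz).trans_ne (neg_ne_zero.2 h))

theorem ellTheta_eq_zero_iff (hp : ‖p‖ < 1) {z : ℂ} (hz : z ≠ 0) :
    ellTheta p z = 0 ↔ ∃ m : ℤ, z = p ^ m := by
  rw [ellTheta_eq_pochInf hp, mul_eq_zero, pochInf_eq_zero_iff hp, pochInf_eq_zero_iff hp]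
  constructor
  · rintro (⟨j, hj⟩ | ⟨j, hj⟩)
    · exact ⟨-j, by rw [zpow_neg, zpow_natCast, eq_inv_of_mul_eq_one_right hj]⟩
    · refine ⟨(j + 1 : ℕ), ?_⟩
      rw [zpow_natCast, pow_succ, ← (div_eq_one_iff_eq hz).1 ((mul_div_assoc _ _ _).trans hj)]
  · rintro ⟨m | j, rfl⟩
    · rcases m with - | j
      · exact Or.inl ⟨0, by simp⟩
      · refine Or.inr ⟨j, ?_⟩
        rw [Int.ofNat_eq_natCast, zpow_natCast] at hz ⊢
        rw [← mul_div_assoc, ← pow_succ, div_self hz]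
    · rw [zpow_negSucc] at hz ⊢
      exact Or.inl ⟨j + 1, mul_inv_cancel₀ fun h => hz (inv_eq_zero.2 h)⟩

theorem ellTheta_div_eq_zero (hp : ‖p‖ < 1) {x y : ℂ} (hx : x ≠ 0) (hy : y ≠ 0)
    (hθx : ellTheta p x = 0) (hθy : ellTheta p y = 0) : ellTheta p (x / y) = 0 := by
  refine (ellTheta_eq_zero_iff hp (div_ne_zero hx hy)).2 ?_
  obtain ⟨m, rfl⟩ := (ellTheta_eq_zero_iff hp hx).1 hθx
  obtain ⟨l, rfl⟩ := (ellTheta_eq_zero_iff hp hy).1 hθy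
  rcases eq_or_ne p 0 with rfl | hp0
  · obtain rfl : m = 0 := by_contra fun h => hx (zero_zpow m h)
    obtain rfl : l = 0 := by_contra fun h => hy (zero_zpow l h)
    exact ⟨0, by simp⟩
  · exact ⟨m - l, (zpow_sub₀ hp0 m l).symm⟩

/-- Euler's coefficients `(-1)^n p^{n(n-1)/2} / (p; p)_n` of the power series of `(z; p)_∞`. -/
noncomputable def eulerCoeff (p : ℂ) (n : ℕ) : ℂ := ∏ j ∈ range n, -(p ^ j / (1 - p ^ (j + 1)))

theorem one_sub_pow_succ_ne_zero (hp : ‖p‖ < 1) (n : ℕ) : 1 - p ^ (n + 1) ≠ 0 := fun h =>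
  (pow_lt_one₀ (norm_nonneg p) hp n.succ_ne_zero).ne <| by
    rw [← norm_pow, ← sub_eq_zero.1 h, norm_one]

theorem eulerCoeff_succ_mul (hp : ‖p‖ < 1) (n : ℕ) :
    eulerCoeff p (n + 1) * (1 - p ^ (n + 1)) = -(p ^ n * eulerCoeff p n) := by
  have := one_sub_pow_succ_ne_zero hp n
  rw [eulerCoeff, prod_range_succ, eulerCoeff]
  field_simp

theorem radius_ofScalars_eulerCoeff (hp : ‖p‖ < 1) (hp0 : p ≠ 0) :
    (FormalMultilinearSeries.ofScalars ℂ (eulerCoeff p)).radius = ⊤ := by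
  have hne (n : ℕ) : eulerCoeff p n ≠ 0 := prod_ne_zero_iff.2 fun j _ =>
    neg_ne_zero.2 (div_ne_zero (pow_ne_zero j hp0) (one_sub_pow_succ_ne_zero hp j))
  refine FormalMultilinearSeries.ofScalars_radius_eq_top_of_tendsto _ _ (.of_forall hne) ?_
  have hratio (n : ℕ) : ‖p ^ n / (1 - p ^ (n + 1))‖ =
      ‖eulerCoeff p n.succ‖ / ‖eulerCoeff p n‖ := by
    rw [← norm_div, eulerCoeff, prod_range_succ, ← eulerCoeff, mul_div_cancel_left₀ _ (hne n),
      norm_neg]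
  have hpow := tendsto_pow_atTop_nhds_zero_of_norm_lt_one hp
  have hlim := (hpow.div (((tendsto_add_atTop_iff_nat 1).2 hpow).const_sub 1) (by simp)).norm
  exact Tendsto.congr hratio (by simpa using hlim)

theorem hasSum_pochInf (hp : ‖p‖ < 1) (hp0 : p ≠ 0) (z : ℂ) :
    HasSum (fun n => eulerCoeff p n * z ^ n) (pochInf p z) := by
  set F := FormalMultilinearSeries.ofScalars ℂ (eulerCoeff p)
  have hF := F.hasFPowerSeriesOnBall (by simp [F, radius_ofScalars_eulerCoeff hp hp0])
  rw [radius_ofScalars_eulerCoeff hp hp0] at hF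
  have hsum (z : ℂ) : HasSum (fun n => eulerCoeff p n * z ^ n) (F.sum z) := by
    simpa [F, mul_comm] using hF.hasSum (y := z) (by simp)
  have hF0 : F.sum 0 = 1 := by
    refine (hsum 0).unique ?_
    convert hasSum_single (f := fun n => eulerCoeff p n * 0 ^ n) 0 (fun n hn => by simp [hn])
    simp [eulerCoeff]
  have hfun (z : ℂ) : F.sum z = (1 - z) * F.sum (p * z) := by
    have h := (hsum z).sub (hsum (p * z))
    rw [← hasSum_nat_add_iff' 1] at h
    have h' := h.unique (((hsum (p * z)).mul_left (-z)).congr_fun fun n => by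
      linear_combination z ^ (n + 1) * eulerCoeff_succ_mul hp n)
    simp only [range_one, sum_singleton, pow_zero, sub_self, sub_zero] at h'
    linear_combination h'
  have hcont : ContinuousAt F.sum 0 := hF.continuousOn.continuousAt (by simp)
  have := eq_mul_pochInf hp hcont hfun z
  rw [hF0, one_mul] at this
  exact this ▸ hsum z

/-- Euler's coefficients, extended by zero to negative indices. -/
noncomputable def eulerCoeffInt (p : ℂ) (n : ℤ) : ℂ := if 0 ≤ n then eulerCoeff p n.toNat else 0

theorem eulerCoeffInt_succ_mul (hp : ‖p‖ < 1) (n : ℤ) :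
    eulerCoeffInt p (n + 1) * (1 - p ^ (n + 1)) = -(p ^ n * eulerCoeffInt p n) := by
  rcases lt_trichotomy n (-1) with h | rfl | h
  · simp [eulerCoeffInt, show ¬ 0 ≤ n + 1 by omega, show ¬ 0 ≤ n by omega]
  · simp [eulerCoeffInt]
  · obtain ⟨k, rfl⟩ := Int.eq_ofNat_of_zero_le (show 0 ≤ n by omega)
    simpa [eulerCoeffInt, show (0 : ℤ) ≤ k + 1 by omega, show ((k : ℤ) + 1).toNat = k + 1 by omega,
      ← zpow_natCast] using eulerCoeff_succ_mul hp k

theorem hasSum_eulerCoeffInt (hp : ‖p‖ < 1) (hp0 : p ≠ 0) (z : ℂ) :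
    HasSum (fun n : ℤ => eulerCoeffInt p n * z ^ n) (pochInf p z) := by
  rw [← (Nat.cast_injective (R := ℤ)).hasSum_iff fun n hn => ?_]
  · simpa [Function.comp_def, eulerCoeffInt] using hasSum_pochInf hp hp0 z
  · have : ¬ 0 ≤ n := fun h => hn ⟨n.toNat, by simp [h]⟩
    simp [eulerCoeffInt, this]

theorem hasSum_mul_prod {ι κ : Type*} {f : ι → ℂ} {g : κ → ℂ} {a b : ℂ} (hf : HasSum f a)
    (hg : HasSum g b) : HasSum (fun i : ι × κ => f i.1 * g i.2) (a * b) :=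
  hf.mul hg (summable_mul_of_summable_norm hf.summable.norm hg.summable.norm)

theorem hasSum_eulerCoeffInt_shear (hp : ‖p‖ < 1) (hp0 : p ≠ 0) (x y : ℂ) :
    HasSum (fun i : ℤ × ℤ => eulerCoeffInt p (i.1 + i.2) * x ^ (i.1 + i.2) *
      (eulerCoeffInt p i.2 * y ^ i.2)) (pochInf p x * pochInf p y) := by
  let shear : ℤ × ℤ ≃ ℤ × ℤ :=
    ⟨fun i => (i.1 + i.2, i.2), fun i => (i.1 - i.2, i.2), fun i => by simp, fun i => by simp⟩
  exact shear.hasSum_iff.2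
    (hasSum_mul_prod (hasSum_eulerCoeffInt hp hp0 x) (hasSum_eulerCoeffInt hp hp0 y))

/-- The coefficient of `z^m` in the Laurent expansion of `θ(z) = (z; p)_∞ (p/z; p)_∞`. -/
noncomputable def thetaCoeff (p : ℂ) (m : ℤ) : ℂ :=
  ∑' k : ℤ, eulerCoeffInt p (m + k) * eulerCoeffInt p k * p ^ k

theorem summable_eulerCoeffInt_mul (hp : ‖p‖ < 1) (hp0 : p ≠ 0) (y : ℂ) (m : ℤ) :
    Summable fun k : ℤ => eulerCoeffInt p (m + k) * eulerCoeffInt p k * y ^ k := by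
  refine ((hasSum_eulerCoeffInt_shear hp hp0 1 y).summable.prod_factor m).congr fun k => ?_
  rw [one_zpow]
  ring

theorem hasSum_ellTheta (hp : ‖p‖ < 1) (hp0 : p ≠ 0) {z : ℂ} (hz : z ≠ 0) :
    HasSum (fun m : ℤ => thetaCoeff p m * z ^ m) (ellTheta p z) := by
  rw [ellTheta_eq_pochInf hp]
  refine (hasSum_eulerCoeffInt_shear hp hp0 z (p / z)).prod_fiberwise fun m => ?_
  refine ((summable_eulerCoeffInt_mul hp hp0 p m).hasSum.mul_right (z ^ m)).congr_fun fun k => ?_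
  have := zpow_ne_zero k hz
  rw [zpow_add₀ hz, div_zpow]
  field_simp

theorem thetaCoeff_succ (hp : ‖p‖ < 1) (hp0 : p ≠ 0) (m : ℤ) :
    thetaCoeff p (m + 1) = -(p ^ m * thetaCoeff p m) := by
  have hT := (summable_eulerCoeffInt_mul hp hp0 p m).hasSum
  have hU := (summable_eulerCoeffInt_mul hp hp0 (p * p) m).hasSum
  have hT' := (Equiv.addRight (1 : ℤ)).hasSum_iff.2 hT
  have hU' := (Equiv.addRight (1 : ℤ)).hasSum_iff.2 hU
  have hsum := ((hT'.mul_left (-p ^ m)).add (hU'.mul_left (p ^ m))).sub (hU.mul_left (p ^ m))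
  rw [thetaCoeff, (summable_eulerCoeffInt_mul hp hp0 p (m + 1)).hasSum.unique
    (hsum.congr_fun fun k => ?_), thetaCoeff]
  · ring
  · have h₁ := eulerCoeffInt_succ_mul hp (m + k)
    have h₂ := eulerCoeffInt_succ_mul hp k
    simp only [Function.comp_apply, Equiv.coe_addRight]
    rw [show m + 1 + k = m + k + 1 by ring, show m + (k + 1) = m + k + 1 by ring, mul_zpow,
      mul_zpow, zpow_add_one₀ hp0]
    rw [zpow_add_one₀ hp0, zpow_add₀ hp0] at h₁
    rw [zpow_add_one₀ hp0] at h₂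
    linear_combination (eulerCoeffInt p k * p ^ k) * h₁ + p ^ m * p ^ k * p *
      eulerCoeffInt p (m + k + 1) * h₂

theorem thetaCoeff_eq (hp : ‖p‖ < 1) (hp0 : p ≠ 0) (m : ℤ) :
    thetaCoeff p m = thetaCoeff p 0 * ((-1) ^ m * p ^ (m * (m - 1) / 2)) := by
  have hexp (m : ℤ) : (m + 1) * (m + 1 - 1) / 2 = m + m * (m - 1) / 2 := by
    rw [show (m + 1) * (m + 1 - 1) = m * (m - 1) + m * 2 by ring,
      Int.add_mul_ediv_right _ _ two_ne_zero, add_comm]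
  have hsucc (m : ℤ) : (-1) ^ (m + 1) * p ^ ((m + 1) * (m + 1 - 1) / 2) =
      -(p ^ m * ((-1) ^ m * p ^ (m * (m - 1) / 2))) := by
    rw [hexp, zpow_add₀ hp0, zpow_add_one₀ (by norm_num)]
    ring
  induction m with
  | zero => simp
  | succ k ih => rw [thetaCoeff_succ hp hp0, hsucc, ih]; ring
  | pred k ih =>
    have hc := thetaCoeff_succ hp hp0 (-(k : ℤ) - 1)
    have hs := hsucc (-(k : ℤ) - 1)
    rw [sub_add_cancel] at hc hs
    refine mul_left_cancel₀ (zpow_ne_zero (-(k : ℤ) - 1) hp0) ?_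
    linear_combination hc - ih - thetaCoeff p 0 * hs

theorem thetaCoeff_add_mul_sub (hp : ‖p‖ < 1) (hp0 : p ≠ 0) (s t : ℤ) :
    thetaCoeff p (s + t) * thetaCoeff p (s - t) =
      thetaCoeff p 0 ^ 2 * p ^ (s ^ 2 - s) * p ^ t ^ 2 := by
  have hsign : (-1 : ℂ) ^ (s + t) * (-1) ^ (s - t) = 1 := by
    rw [← zpow_add₀ (by norm_num), add_add_sub_cancel, (Even.add_self s).neg_one_zpow]
  obtain ⟨u, hu⟩ := Int.even_mul_pred_self (s + t)
  obtain ⟨v, hv⟩ := Int.even_mul_pred_self (s - t)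
  have hexp : p ^ u * p ^ v = p ^ (s ^ 2 - s) * p ^ t ^ 2 := by
    rw [← zpow_add₀ hp0, ← zpow_add₀ hp0]
    congr 1
    linarith
  rw [thetaCoeff_eq hp hp0 (s + t), thetaCoeff_eq hp hp0 (s - t), hu, hv,
    show (u + u) / 2 = u by omega, show (v + v) / 2 = v by omega]
  linear_combination thetaCoeff p 0 ^ 2 * (p ^ u * p ^ v * hsign + hexp)

theorem thetaCoeff_add_add_one_mul_sub (hp : ‖p‖ < 1) (hp0 : p ≠ 0) (s t : ℤ) :
    thetaCoeff p (s + t + 1) * thetaCoeff p (s - t) =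
      -(thetaCoeff p 0 ^ 2) * p ^ s ^ 2 * p ^ (t ^ 2 + t) := by
  have hexp : p ^ (s + t) * (p ^ (s ^ 2 - s) * p ^ t ^ 2) = p ^ s ^ 2 * p ^ (t ^ 2 + t) := by
    simp only [← zpow_add₀ hp0]
    ring_nf
  rw [thetaCoeff_succ hp hp0]
  linear_combination -p ^ (s + t) * thetaCoeff_add_mul_sub hp hp0 s t - thetaCoeff p 0 ^ 2 * hexp

theorem hasSum_ellTheta_mul_ellTheta (hp : ‖p‖ < 1) (hp0 : p ≠ 0) {x y : ℂ} (hx : x ≠ 0)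
    (hy : y ≠ 0) : HasSum (fun i : ℤ × ℤ => thetaCoeff p i.1 * thetaCoeff p i.2 *
      x ^ (i.1 + i.2) * y ^ (i.1 - i.2)) (ellTheta p (x * y) * ellTheta p (x / y)) := by
  refine (hasSum_mul_prod (hasSum_ellTheta hp hp0 (mul_ne_zero hx hy))
    (hasSum_ellTheta hp hp0 (div_ne_zero hx hy))).congr_fun fun i => ?_
  rw [mul_zpow, div_zpow, zpow_add₀ hx, zpow_sub₀ hy]
  ring

theorem tsum_int_prod_eq_even_add_odd {f : ℤ × ℤ → ℂ} (hf : Summable f) :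
    ∑' i, f i = (∑' (s : ℤ) (t : ℤ), f (s + t, s - t)) +
      ∑' (s : ℤ) (t : ℤ), f (s + t + 1, s - t) := by
  let even (i : ℤ × ℤ) : ℤ × ℤ := (i.1 + i.2, i.1 - i.2)
  let odd (i : ℤ × ℤ) : ℤ × ℤ := (i.1 + i.2 + 1, i.1 - i.2)
  have heven : Function.Injective even := fun i j h => by
    simp only [even, Prod.mk.injEq] at h
    exact Prod.ext (by omega) (by omega)
  have hodd : Function.Injective odd := fun i j h => by
    simp only [odd, Prod.mk.injEq] at h
    exact Prod.ext (by omega) (by omega)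
  have hcompl : IsCompl (Set.range even) (Set.range odd) := by
    refine isCompl_iff.2 ⟨Set.disjoint_left.2 ?_, codisjoint_iff_le_sup.2 ?_⟩
    · rintro _ ⟨i, rfl⟩ ⟨j, hj⟩
      simp only [even, odd, Prod.mk.injEq] at hj
      omega
    · rintro ⟨m, n⟩ -
      rcases Int.even_or_odd' (m + n) with ⟨s, hs | hs⟩
      · exact Or.inl ⟨(s, m - s), Prod.ext (by simp [even]) (by simp only [even]; omega)⟩
      · exact Or.inr ⟨(s, m - s - 1),
          Prod.ext (by simp only [odd]; omega) (by simp only [odd]; omega)⟩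
  have hsum_even := hf.comp_injective heven
  have hsum_odd := hf.comp_injective hodd
  have h := HasSum.add_isCompl hcompl (heven.hasSum_range_iff.2 hsum_even.hasSum)
    (hodd.hasSum_range_iff.2 hsum_odd.hasSum)
  rw [h.tsum_eq, hsum_even.tsum_prod, hsum_odd.tsum_prod]
  rfl

/- In the double Laurent series of `θ(xy) θ(x/y)` the variables separate in the terms with even
total degree in `x`, and likewise in those with odd one; hence the product has rank two. -/
theorem exists_ellTheta_mul_eq (hp : ‖p‖ < 1) :
    ∃ f g f' g' : ℂ → ℂ, ∀ x y : ℂ, x ≠ 0 → y ≠ 0 →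
      ellTheta p (x * y) * ellTheta p (x / y) = f x * g y + f' x * g' y := by
  rcases eq_or_ne p 0 with rfl | hp0
  · have hθ (z : ℂ) : ellTheta 0 z = 1 - z := by
      rw [ellTheta_eq_pochInf (by simp), pochInf_eq_one_sub_mul (by simp) z]
      simp [pochInf]
    refine ⟨fun x => 1 + x ^ 2, fun _ => 1, fun x => -x, fun y => y + y⁻¹, fun x y _ hy => ?_⟩
    rw [hθ, hθ]
    field_simp
    ring
  refine ⟨fun x => ∑' s : ℤ, thetaCoeff p 0 ^ 2 * p ^ (s ^ 2 - s) * x ^ (2 * s),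
    fun y => ∑' t : ℤ, p ^ t ^ 2 * y ^ (2 * t),
    fun x => ∑' s : ℤ, -(thetaCoeff p 0 ^ 2) * p ^ s ^ 2 * x ^ (2 * s + 1),
    fun y => ∑' t : ℤ, p ^ (t ^ 2 + t) * y ^ (2 * t + 1), fun x y hx hy => ?_⟩
  have h := hasSum_ellTheta_mul_ellTheta hp hp0 hx hy
  rw [← h.tsum_eq, tsum_int_prod_eq_even_add_odd h.summable]
  simp only [thetaCoeff_add_mul_sub hp hp0, thetaCoeff_add_add_one_mul_sub hp hp0]
  rw [← tsum_mul_right, ← tsum_mul_right]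
  simp only [← tsum_mul_left]
  congr 1 <;> refine tsum_congr fun s => tsum_congr fun t => ?_
  · rw [show s + t + (s - t) = 2 * s by ring, show s + t - (s - t) = 2 * t by ring]
    ring
  · rw [show s + t + 1 + (s - t) = 2 * s + 1 by ring, show s + t + 1 - (s - t) = 2 * t + 1 by ring]
    ring

/-- The algebraic properties shared by Weierstrass's sigma function and its degenerations, on which
all identities below rest. -/
structure IsSigma (σ : ℂ → ℂ) : Prop where
  odd : ∀ x, σ (-x) = -σ x
  add_formula : ∀ x y u v, σ (x + y) * σ (x - y) * (σ (u + v) * σ (u - v)) =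
    σ (x + u) * σ (x - u) * (σ (y + v) * σ (y - v)) -
      σ (x + v) * σ (x - v) * (σ (y + u) * σ (y - u))
  sub_eq_zero : ∀ x y, σ x = 0 → σ y = 0 → σ (x - y) = 0

/-- The theta function in additive notation, normalized to be odd. -/
noncomputable def thetaSigma (p x : ℂ) : ℂ := Complex.exp (-x / 2) * ellTheta p (Complex.exp x)

theorem ellTheta_exp (p x : ℂ) :
    ellTheta p (Complex.exp x) = Complex.exp (x / 2) * thetaSigma p x := by
  rw [thetaSigma, ← mul_assoc, ← Complex.exp_add, neg_div, add_neg_cancel, Complex.exp_zero,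
    one_mul]

theorem thetaSigma_eq_zero_iff (p x : ℂ) :
    thetaSigma p x = 0 ↔ ellTheta p (Complex.exp x) = 0 := by
  simp [thetaSigma, Complex.exp_ne_zero]

theorem thetaSigma_neg (hp : ‖p‖ < 1) (x : ℂ) : thetaSigma p (-x) = -thetaSigma p x := by
  have hexp : Complex.exp (x / 2) = Complex.exp (-x / 2) * Complex.exp x := by
    rw [← Complex.exp_add]
    ring_nf
  rw [thetaSigma, thetaSigma, neg_neg, Complex.exp_neg, hexp]
  linear_combination Complex.exp (-x / 2) * ellTheta_inv hp (Complex.exp_ne_zero x)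

theorem plucker_of_rank_two {ι R : Type*} [CommRing R] [IsReduced R] {F : ι → ι → R}
    (hself : ∀ x, F x x = 0) (hF : ∀ x y, F x y = -F y x) {f g f' g' : ι → R}
    (h : ∀ x y, F x y = f x * g y + f' x * g' y) (x y u v : ι) :
    F x y * F u v - F x u * F y v + F x v * F y u = 0 := by
  -- the Pfaffian of a `4 × 4` minor, whose square is the determinant
  have hdet : (!![F x x, F x y, F x u, F x v; F y x, F y y, F y u, F y v;
      F u x, F u y, F u u, F u v; F v x, F v y, F v u, F v v] : Matrix (Fin 4) (Fin 4) R).det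
      = 0 := by
    simp only [h, Matrix.det_succ_row_zero, Fin.sum_univ_succ]
    simp [Fin.succAbove]
    ring
  rw [hself, hself, hself, hself, hF y x, hF u x, hF v x, hF u y, hF v y, hF v u] at hdet
  refine (pow_eq_zero_iff two_ne_zero).1 (Eq.trans ?_ hdet)
  simp [Matrix.det_succ_row_zero, Fin.sum_univ_succ, Fin.succAbove]
  ring

theorem thetaSigma_add_formula (hp : ‖p‖ < 1) (x y u v : ℂ) :
    thetaSigma p (x + y) * thetaSigma p (x - y) * (thetaSigma p (u + v) * thetaSigma p (u - v)) =
      thetaSigma p (x + u) * thetaSigma p (x - u) *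
          (thetaSigma p (y + v) * thetaSigma p (y - v)) -
        thetaSigma p (x + v) * thetaSigma p (x - v) *
          (thetaSigma p (y + u) * thetaSigma p (y - u)) := by
  obtain ⟨f, g, f', g', hfg⟩ := exists_ellTheta_mul_eq hp
  have hneg (x y : ℂ) : thetaSigma p (x + y) * thetaSigma p (x - y) =
      -(thetaSigma p (y + x) * thetaSigma p (y - x)) := by
    rw [← neg_sub x y, thetaSigma_neg hp, add_comm y x]
    ring
  have hrank (x y : ℂ) : thetaSigma p (x + y) * thetaSigma p (x - y) =
      Complex.exp (-x) * f (Complex.exp x) * g (Complex.exp y) +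
        Complex.exp (-x) * f' (Complex.exp x) * g' (Complex.exp y) := by
    have h := hfg _ _ (Complex.exp_ne_zero x) (Complex.exp_ne_zero y)
    have hexp : Complex.exp (-(x + y) / 2) * Complex.exp (-(x - y) / 2) = Complex.exp (-x) := by
      rw [← Complex.exp_add]
      ring_nf
    rw [← Complex.exp_add, ← Complex.exp_sub] at h
    rw [thetaSigma, thetaSigma]
    linear_combination Complex.exp (-(x + y) / 2) * Complex.exp (-(x - y) / 2) * h +
      (f (Complex.exp x) * g (Complex.exp y) + f' (Complex.exp x) * g' (Complex.exp y)) * hexp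
  linear_combination plucker_of_rank_two (fun x => self_eq_neg.1 (hneg x x)) hneg hrank x y u v

theorem isSigma_thetaSigma (hp : ‖p‖ < 1) : IsSigma (thetaSigma p) where
  odd := thetaSigma_neg hp
  add_formula := thetaSigma_add_formula hp
  sub_eq_zero x y hx hy := by
    rw [thetaSigma_eq_zero_iff] at *
    rw [Complex.exp_sub]
    exact ellTheta_div_eq_zero hp (Complex.exp_ne_zero x) (Complex.exp_ne_zero y) hx hy

end Theta

/-! ### Partial fractions -/

/-- The (at most two-dimensional) space of even sigma functions of degree two about `P / 2`: the
functions that are recovered from any two of their values by Lagrange interpolation. -/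
def sigmaSpace (σ : ℂ → ℂ) (P : ℂ) : Submodule ℂ (ℂ → ℂ) where
  carrier := {F | ∀ b u v, F b * (σ (u + v - P) * σ (u - v)) =
    F u * (σ (b + v - P) * σ (b - v)) - F v * (σ (b + u - P) * σ (b - u))}
  zero_mem' b u v := by simp only [Pi.zero_apply, zero_mul, sub_zero]
  add_mem' hF hG b u v := by
    simp only [Pi.add_apply]
    linear_combination hF b u v + hG b u v
  smul_mem' c F hF b u v := by
    simp only [Pi.smul_apply, smul_eq_mul]
    linear_combination c * hF b u v

/-- The product of four sigma functions, of a shape depending on the parity of `n`, that evaluates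
the type `D` partial fraction sum `IsSigma.sum_prod_mul_div_eq` over `n` nodes with sum `W`. -/
noncomputable def parityProd (σ : ℂ → ℂ) (n : ℕ) (W x₁ x₂ x₃ x₄ : ℂ) : ℂ :=
  if Odd n then σ (W + x₁) * σ (W + x₂) * σ (W + x₃) * σ (W + x₄)
  else σ W * σ (W + x₁ + x₂) * σ (W + x₁ + x₃) * σ (W + x₁ + x₄)

theorem parityProd_succ (σ : ℂ → ℂ) (n : ℕ) (W u x₂ x₃ x₄ : ℂ) :
    parityProd σ (n + 1) (W + u) (-u) x₂ x₃ x₄ = parityProd σ n W u x₂ x₃ x₄ := by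
  rcases Nat.even_or_odd n with h | h
  · rw [parityProd, parityProd, if_pos h.add_one, if_neg (Nat.not_odd_iff_even.2 h),
      add_neg_cancel_right]
  · rw [parityProd, parityProd, if_neg (Nat.not_odd_iff_even.2 h.add_one), if_pos h,
      add_neg_cancel_right]

theorem univ_erase_inl {α β : Type*} [Fintype α] [Fintype β] [DecidableEq α] [DecidableEq β]
    (a : α) : (univ : Finset (α ⊕ β)).erase (Sum.inl a) = (univ.erase a).disjSum univ := by
  ext (x | x) <;> simp

theorem univ_erase_inr {α β : Type*} [Fintype α] [Fintype β] [DecidableEq α] [DecidableEq β]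
    (b : β) : (univ : Finset (α ⊕ β)).erase (Sum.inr b) = univ.disjSum (univ.erase b) := by
  ext (x | x) <;> simp

namespace IsSigma

variable {σ : ℂ → ℂ} {ι κ : Type*}

theorem zero (hσ : IsSigma σ) : σ 0 = 0 :=
  self_eq_neg.1 (by simpa only [neg_zero] using hσ.odd 0)

theorem sub_comm (hσ : IsSigma σ) (x y : ℂ) : σ (x - y) = -σ (y - x) := by
  rw [← hσ.odd, neg_sub]

theorem sub_ne_zero_comm (hσ : IsSigma σ) {x y : ℂ} : σ (x - y) ≠ 0 ↔ σ (y - x) ≠ 0 := by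
  rw [hσ.sub_comm, neg_ne_zero]

theorem add_mul_add_mem_sigmaSpace (hσ : IsSigma σ) (P x : ℂ) :
    (fun b => σ (x + b) * σ (x + (P - b))) ∈ sigmaSpace σ P := by
  intro b u v
  have h := hσ.add_formula (x + P / 2) (b - P / 2) (u - P / 2) (v - P / 2)
  have hadd (x y : ℂ) : x + P / 2 + (y - P / 2) = x + y := by ring
  have hsub (x y : ℂ) : x + P / 2 - (y - P / 2) = x + (P - y) := by ring
  have hadd' (x y : ℂ) : x - P / 2 + (y - P / 2) = x + y - P := by ring
  simpa only [hadd, hsub, hadd', sub_sub_sub_cancel_right] using h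

theorem sub_mul_sub_mem_sigmaSpace (hσ : IsSigma σ) (P x : ℂ) :
    (fun b => σ (x - b) * σ (x - (P - b))) ∈ sigmaSpace σ P := by
  convert hσ.add_mul_add_mem_sigmaSpace P (-x) using 2 with b
  rw [← neg_mul_neg, ← hσ.odd, ← hσ.odd]
  ring_nf

theorem parityProd_mem_sigmaSpace (hσ : IsSigma σ) (n : ℕ) {W P x₃ x₄ : ℂ}
    (hx : P + x₃ + x₄ + 2 * W = 0) :
    (fun b => parityProd σ n W b (P - b) x₃ x₄) ∈ sigmaSpace σ P := by
  unfold parityProd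
  split_ifs
  · convert (sigmaSpace σ P).smul_mem (σ (W + x₃) * σ (W + x₄))
      (hσ.add_mul_add_mem_sigmaSpace P W) using 1
    ext b
    simp only [Pi.smul_apply, smul_eq_mul]
    ring
  · convert (sigmaSpace σ P).smul_mem (-(σ W * σ (W + P)))
      (hσ.add_mul_add_mem_sigmaSpace P (W + x₃)) using 1
    ext b
    have hneg : σ (W + x₃ + (P - b)) = -σ (W + b + x₄) := by
      rw [← hσ.odd]
      congr 1
      linear_combination hx
    rw [Pi.smul_apply, smul_eq_mul, hneg, add_assoc W b, add_sub_cancel, add_right_comm W x₃]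
    ring

theorem eq_of_mem_sigmaSpace (hσ : IsSigma σ) {P : ℂ} {F G : ℂ → ℂ} (hF : F ∈ sigmaSpace σ P)
    (hG : G ∈ sigmaSpace σ P) {s : Finset ι} (hs : 2 < #s) {w : ι → ℂ}
    (hw : ∀ i ∈ s, ∀ j ∈ s, i ≠ j → σ (w i - w j) ≠ 0) (h : ∀ i ∈ s, F (w i) = G (w i)) :
    F = G := by
  obtain ⟨i, hi, j, hj, k, hk, hij, hik, hjk⟩ := two_lt_card.1 hs
  suffices hmain : ∀ l ∈ s, i ≠ l → σ (w i + w l - P) ≠ 0 → F = G by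
    by_contra hne
    refine hw j hj k hk hjk ?_
    have := hσ.sub_eq_zero _ _ (not_not.1 (mt (hmain j hj hij) hne))
      (not_not.1 (mt (hmain k hk hik) hne))
    rwa [sub_sub_sub_cancel_right, add_sub_add_left_eq_sub] at this
  intro l hl hil hP
  ext b
  refine mul_right_cancel₀ (mul_ne_zero hP (hw i hi l hl hil)) ?_
  rw [hF, hG, h i hi, h l hl]

variable [DecidableEq ι]

theorem sum_prod_div_eq_zero_of_card_two (hσ : IsSigma σ) {s : Finset ι} {t : Finset κ}
    (hs : #s = 2) (ht : #t = 2) {a : ι → ℂ} {b : κ → ℂ} (hab : ∑ i ∈ s, a i = ∑ j ∈ t, b j)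
    (ha : ∀ i ∈ s, ∀ j ∈ s, i ≠ j → σ (a i - a j) ≠ 0) :
    ∑ k ∈ s, (∏ j ∈ t, σ (a k - b j)) / ∏ j ∈ s.erase k, σ (a k - a j) = 0 := by
  classical
  obtain ⟨i, j, hij, rfl⟩ := card_eq_two.1 hs
  obtain ⟨k, l, hkl, rfl⟩ := card_eq_two.1 ht
  have hne := ha i (by simp) j (by simp) hij
  rw [sum_pair hij, sum_pair hkl] at hab
  rw [sum_pair hij, prod_pair hkl, prod_pair hkl, erase_insert (by simpa using hij), pair_comm,
    erase_insert (by simpa using hij.symm), prod_singleton, prod_singleton,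
    show a j - b k = b l - a i by linear_combination hab,
    show a j - b l = b k - a i by linear_combination hab,
    hσ.sub_comm (b l), hσ.sub_comm (b k), hσ.sub_comm (a j)]
  field_simp
  ring

theorem sum_prod_div_eq_sum_erase [DecidableEq κ] (hσ : IsSigma σ) {s : Finset ι}
    {t : Finset κ} {a : ι → ℂ} {b : κ → ℂ} (ha : ∀ i ∈ s, ∀ j ∈ s, i ≠ j → σ (a i - a j) ≠ 0)
    {u : ι} (hu : u ∈ s) {m : κ} (hm : m ∈ t) (hum : b m = a u) :
    ∑ k ∈ s, (∏ j ∈ t, σ (a k - b j)) / ∏ j ∈ s.erase k, σ (a k - a j) =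
      ∑ k ∈ s.erase u, (∏ j ∈ t.erase m, σ (a k - b j)) /
        ∏ j ∈ (s.erase u).erase k, σ (a k - a j) := by
  rw [← add_sum_erase _ _ hu, ← mul_prod_erase _ _ hm, hum, sub_self, hσ.zero, zero_mul, zero_div,
    zero_add]
  refine sum_congr rfl fun k hk => ?_
  have hne := ha k (mem_of_mem_erase hk) u hu (ne_of_mem_erase hk)
  rw [← mul_prod_erase t _ hm, hum, erase_right_comm,
    ← mul_prod_erase (s.erase k) _ (mem_erase.2 ⟨(ne_of_mem_erase hk).symm, hu⟩),
    mul_div_mul_left _ _ hne]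

theorem sum_prod_div_mem_sigmaSpace [DecidableEq κ] (hσ : IsSigma σ) (s : Finset ι) {t : Finset κ}
    (a : ι → ℂ) {b : ℂ → κ → ℂ} {b₀ : κ → ℂ} {P : ℂ} {m l : κ} (hm : m ∈ t) (hl : l ∈ t.erase m)
    (hbm : ∀ x, b x m = x) (hbl : ∀ x, b x l = P - x)
    (hb : ∀ x, ∀ j ∈ (t.erase m).erase l, b x j = b₀ j) :
    (fun x => ∑ k ∈ s, (∏ j ∈ t, σ (a k - b x j)) / ∏ j ∈ s.erase k, σ (a k - a j)) ∈
      sigmaSpace σ P := by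
  convert (sigmaSpace σ P).sum_mem (t := s) fun k _ => (sigmaSpace σ P).smul_mem
    ((∏ j ∈ (t.erase m).erase l, σ (a k - b₀ j)) / ∏ j ∈ s.erase k, σ (a k - a j))
    (hσ.sub_mul_sub_mem_sigmaSpace P (a k)) using 1
  ext x
  rw [Finset.sum_apply]
  refine sum_congr rfl fun k _ => ?_
  rw [Pi.smul_apply, smul_eq_mul, ← mul_prod_erase _ _ hm, ← mul_prod_erase _ _ hl, hbm, hbl,
    prod_congr rfl fun j hj => by rw [hb x j hj]]
  ring

/- The partial fraction identity of type `A`. As a function of `b m`, with `b m + b l` fixed, the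
sum lies in `sigmaSpace`, and if `b m` is one of the poles a factor cancels. -/
theorem sum_prod_div_eq_zero (hσ : IsSigma σ) {s : Finset ι} {t : Finset κ} (hst : #s = #t)
    {a : ι → ℂ} {b : κ → ℂ} (hab : ∑ i ∈ s, a i = ∑ j ∈ t, b j)
    (ha : ∀ i ∈ s, ∀ j ∈ s, i ≠ j → σ (a i - a j) ≠ 0) :
    ∑ k ∈ s, (∏ j ∈ t, σ (a k - b j)) / ∏ j ∈ s.erase k, σ (a k - a j) = 0 := by
  classical
  induction hn : #s generalizing s t b with
  | zero => rw [card_eq_zero.1 hn, sum_empty]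
  | succ n ih =>
    rw [hn] at hst
    rcases (show n = 0 ∨ n = 1 ∨ 2 < #s by omega) with rfl | rfl | hs
    · obtain ⟨i, rfl⟩ := card_eq_one.1 hn
      obtain ⟨j, rfl⟩ := card_eq_one.1 hst.symm
      rw [sum_singleton, sum_singleton] at hab
      simp [hab, hσ.zero]
    · exact hσ.sum_prod_div_eq_zero_of_card_two hn hst.symm hab ha
    obtain ⟨m, hm, l, hl, hml⟩ := one_lt_card.1 (show 1 < #t by omega)
    have hlm : l ∈ t.erase m := mem_erase.2 ⟨hml.symm, hl⟩
    let b' (x : ℂ) : κ → ℂ := Function.update (Function.update b l (b m + b l - x)) m x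
    have hb'm (x : ℂ) : b' x m = x := Function.update_self ..
    have hb'l (x : ℂ) : b' x l = b m + b l - x := by simp [b', hml.symm]
    have hb' (x : ℂ) (j : κ) (hj : j ∈ (t.erase m).erase l) : b' x j = b j := by
      simp only [mem_erase] at hj
      simp [b', hj.1, hj.2.1]
    let F (x : ℂ) : ℂ := ∑ k ∈ s, (∏ j ∈ t, σ (a k - b' x j)) / ∏ j ∈ s.erase k, σ (a k - a j)
    have hF : F ∈ sigmaSpace σ (b m + b l) :=
      hσ.sum_prod_div_mem_sigmaSpace s a hm hlm hb'm hb'l hb'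
    have hnode (u : ι) (hu : u ∈ s) : F (a u) = 0 := by
      refine (hσ.sum_prod_div_eq_sum_erase ha hu hm (hb'm _)).trans (ih ?_ ?_
        (fun i hi j hj => ha i (mem_of_mem_erase hi) j (mem_of_mem_erase hj)) ?_)
      · rw [card_erase_of_mem hu, card_erase_of_mem hm, hn, hst]
      · rw [← add_sum_erase _ _ hu, ← add_sum_erase _ _ hm, ← add_sum_erase _ _ hlm] at hab
        rw [← add_sum_erase _ _ hlm, hb'l, sum_congr rfl (hb' (a u))]
        linear_combination hab
      · rw [card_erase_of_mem hu, hn, Nat.add_sub_cancel]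
    have hself : b' (b m) = b := by simp [b']
    simpa only [F, hself, Pi.zero_apply] using
      congrFun (hσ.eq_of_mem_sigmaSpace hF (Submodule.zero_mem _) hs ha hnode) (b m)

theorem sum_prod_mul_div_eq_of_card_two (hσ : IsSigma σ) {s : Finset ι} (hs : #s = 2)
    {w : ι → ℂ} {x₁ x₂ x₃ x₄ : ℂ} (hx : x₁ + x₂ + x₃ + x₄ + 2 * ∑ i ∈ s, w i = 0)
    (hw : ∀ i ∈ s, ∀ j ∈ s, i ≠ j → σ (w i - w j) ≠ 0) :
    ∑ k ∈ s, (∏ j ∈ s.erase k, σ (w k + w j) / σ (w k - w j)) *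
      (σ (w k + x₁) * σ (w k + x₂) * σ (w k + x₃) * σ (w k + x₄)) =
      parityProd σ 2 (∑ i ∈ s, w i) x₁ x₂ x₃ x₄ := by
  obtain ⟨i, j, hij, rfl⟩ := card_eq_two.1 hs
  have hne := hw i (by simp) j (by simp) hij
  rw [sum_pair hij] at hx
  have hadd := hσ.add_formula (w i + (x₁ + x₂) / 2) (w i + (x₃ + x₄) / 2)
    ((x₁ - x₂) / 2) ((x₃ - x₄) / 2)
  rw [show w i + (x₁ + x₂) / 2 + (w i + (x₃ + x₄) / 2) = w i - w j by linear_combination hx / 2,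
    show w i + (x₁ + x₂) / 2 - (w i + (x₃ + x₄) / 2) = w i + w j + x₁ + x₂ by
      linear_combination -hx / 2,
    show (x₁ - x₂) / 2 + (x₃ - x₄) / 2 = w i + w j + x₁ + x₃ by linear_combination -hx / 2,
    show (x₁ - x₂) / 2 - (x₃ - x₄) / 2 = w i + w j + x₁ + x₄ by linear_combination -hx / 2,
    show w i + (x₁ + x₂) / 2 + (x₁ - x₂) / 2 = w i + x₁ by ring,
    show w i + (x₁ + x₂) / 2 - (x₁ - x₂) / 2 = w i + x₂ by ring,
    show w i + (x₃ + x₄) / 2 + (x₃ - x₄) / 2 = w i + x₃ by ring,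
    show w i + (x₃ + x₄) / 2 - (x₃ - x₄) / 2 = w i + x₄ by ring,
    show w i + (x₁ + x₂) / 2 + (x₃ - x₄) / 2 = -(w j + x₄) by linear_combination hx / 2,
    show w i + (x₁ + x₂) / 2 - (x₃ - x₄) / 2 = -(w j + x₃) by linear_combination hx / 2,
    show w i + (x₃ + x₄) / 2 + (x₁ - x₂) / 2 = -(w j + x₂) by linear_combination hx / 2,
    show w i + (x₃ + x₄) / 2 - (x₁ - x₂) / 2 = -(w j + x₁) by linear_combination hx / 2] at hadd
  simp only [hσ.odd] at hadd
  rw [sum_pair hij, sum_pair hij, erase_insert (by simpa using hij), pair_comm,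
    erase_insert (by simpa using hij.symm), prod_singleton, prod_singleton,
    hσ.sub_comm (w j), parityProd, if_neg (by decide), add_comm (w j)]
  field_simp
  linear_combination -σ (w i + w j) * hadd

theorem sum_prod_mul_div_eq_sum_erase (hσ : IsSigma σ) {s : Finset ι} {w : ι → ℂ}
    (hw : ∀ i ∈ s, ∀ j ∈ s, i ≠ j → σ (w i - w j) ≠ 0) {u : ι} (hu : u ∈ s) (x₂ x₃ x₄ : ℂ) :
    ∑ k ∈ s, (∏ j ∈ s.erase k, σ (w k + w j) / σ (w k - w j)) *
      (σ (w k + -w u) * σ (w k + x₂) * σ (w k + x₃) * σ (w k + x₄)) =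
      ∑ k ∈ s.erase u, (∏ j ∈ (s.erase u).erase k, σ (w k + w j) / σ (w k - w j)) *
        (σ (w k + w u) * σ (w k + x₂) * σ (w k + x₃) * σ (w k + x₄)) := by
  rw [← add_sum_erase _ _ hu, add_neg_cancel, hσ.zero, zero_mul, zero_mul, zero_mul, mul_zero,
    zero_add]
  refine sum_congr rfl fun k hk => ?_
  have hne := hw k (mem_of_mem_erase hk) u hu (ne_of_mem_erase hk)
  rw [← mul_prod_erase (s.erase k) _ (mem_erase.2 ⟨(ne_of_mem_erase hk).symm, hu⟩),
    erase_right_comm, ← sub_eq_add_neg]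
  field_simp

/- The partial fraction identity of type `D`. With `x₁ + x₂` fixed, both sides lie in `sigmaSpace`
as functions of `x₁`, and if `x₁ = -w u` a factor cancels. -/
theorem sum_prod_mul_div_eq (hσ : IsSigma σ) {s : Finset ι} {w : ι → ℂ} {x₁ x₂ x₃ x₄ : ℂ}
    (hx : x₁ + x₂ + x₃ + x₄ + 2 * ∑ i ∈ s, w i = 0)
    (hw : ∀ i ∈ s, ∀ j ∈ s, i ≠ j → σ (w i - w j) ≠ 0) :
    ∑ k ∈ s, (∏ j ∈ s.erase k, σ (w k + w j) / σ (w k - w j)) *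
      (σ (w k + x₁) * σ (w k + x₂) * σ (w k + x₃) * σ (w k + x₄)) =
      parityProd σ #s (∑ i ∈ s, w i) x₁ x₂ x₃ x₄ := by
  induction hn : #s generalizing s x₁ x₂ x₃ x₄ with
  | zero => simp [card_eq_zero.1 hn, parityProd, hσ.zero]
  | succ n ih =>
    rcases (show n = 0 ∨ n = 1 ∨ 2 < #s by omega) with rfl | rfl | hs
    · obtain ⟨i, rfl⟩ := card_eq_one.1 hn
      simp [parityProd]
    · exact hσ.sum_prod_mul_div_eq_of_card_two hn hx hw
    set P := x₁ + x₂ with hP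
    let F (x : ℂ) : ℂ := ∑ k ∈ s, (∏ j ∈ s.erase k, σ (w k + w j) / σ (w k - w j)) *
      (σ (w k + x) * σ (w k + (P - x)) * σ (w k + x₃) * σ (w k + x₄))
    have hF : F ∈ sigmaSpace σ P := by
      convert (sigmaSpace σ P).sum_mem (t := s) fun k _ => (sigmaSpace σ P).smul_mem
        ((∏ j ∈ s.erase k, σ (w k + w j) / σ (w k - w j)) * (σ (w k + x₃) * σ (w k + x₄)))
        (hσ.add_mul_add_mem_sigmaSpace P (w k)) using 1
      ext x
      rw [Finset.sum_apply]
      refine sum_congr rfl fun k _ => ?_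
      rw [Pi.smul_apply, smul_eq_mul]
      ring
    have hnode (u : ι) (hu : u ∈ s) :
        F (-w u) = parityProd σ (n + 1) (∑ i ∈ s, w i) (-w u) (P - -w u) x₃ x₄ := by
      rw [← sum_erase_add s w hu, parityProd_succ]
      refine (hσ.sum_prod_mul_div_eq_sum_erase hw hu _ _ _).trans (ih ?_
        (fun i hi j hj => hw i (mem_of_mem_erase hi) j (mem_of_mem_erase hj)) ?_)
      · rw [← add_sum_erase _ _ hu] at hx
        linear_combination hx
      · rw [card_erase_of_mem hu, hn, Nat.add_sub_cancel]
    have hw' (i : ι) (hi : i ∈ s) (j : ι) (hj : j ∈ s) (hij : i ≠ j) : σ (-w i - -w j) ≠ 0 := by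
      rw [neg_sub_neg]
      exact hw j hj i hi hij.symm
    have h := congrFun (hσ.eq_of_mem_sigmaSpace hF
      (hσ.parityProd_mem_sigmaSpace (n + 1) hx) hs hw' hnode) x₁
    simpa only [F, hP, add_sub_cancel_left] using h

theorem sum_prod_div_add_add_eq_zero (hσ : IsSigma σ) {n : ℕ} (a b : Fin n → ℂ) {u v s t : ℂ}
    (hab : ∑ i, a i + (u + v) = ∑ i, b i + (s + t))
    (ha : ∀ i j, i ≠ j → σ (a i - a j) ≠ 0) (hu : ∀ i, σ (u - a i) ≠ 0)
    (hv : ∀ i, σ (v - a i) ≠ 0) (huv : σ (u - v) ≠ 0) :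
    ∑ l, (∏ j, σ (a l - b j)) * (σ (a l - s) * σ (a l - t)) /
        ((∏ j ∈ univ.erase l, σ (a l - a j)) * (σ (a l - u) * σ (a l - v))) +
      ((∏ j, σ (u - b j)) * (σ (u - s) * σ (u - t)) / ((∏ j, σ (u - a j)) * σ (u - v)) +
        (∏ j, σ (v - b j)) * (σ (v - s) * σ (v - t)) / ((∏ j, σ (v - a j)) * σ (v - u))) = 0 := by
  have hne (x y : Fin n ⊕ Fin 2) (hxy : x ≠ y) :
      σ (Sum.elim a ![u, v] x - Sum.elim a ![u, v] y) ≠ 0 := by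
    rcases x with i | i <;> rcases y with j | j
    · exact ha i j fun h => hxy (congrArg _ h)
    · fin_cases j
      exacts [hσ.sub_ne_zero_comm.1 (hu i), hσ.sub_ne_zero_comm.1 (hv i)]
    · fin_cases i
      exacts [hu j, hv j]
    · fin_cases i <;> fin_cases j
      exacts [absurd rfl hxy, huv, hσ.sub_ne_zero_comm.1 huv, absurd rfl hxy]
  have h := hσ.sum_prod_div_eq_zero (s := univ) (t := univ) (b := Sum.elim b ![s, t]) (by simp)
    (by simpa using hab) fun x _ y _ => hne x y
  rw [Fintype.sum_sum_type, Fin.sum_univ_two] at h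
  simpa only [univ_erase_inl, univ_erase_inr, prod_disjSum, Fintype.prod_sum_type,
    Fin.prod_univ_two, Sum.elim_inl, Sum.elim_inr, Matrix.cons_val_zero, Matrix.cons_val_one,
    show (univ : Finset (Fin 2)).erase 0 = {1} by decide,
    show (univ : Finset (Fin 2)).erase 1 = {0} by decide, prod_singleton] using h

theorem sum_prod_mul_div_add_eq (hσ : IsSigma σ) {n : ℕ} (w : Fin n → ℂ) {u x₁ x₂ x₃ x₄ : ℂ}
    (hx : x₁ + x₂ + x₃ + x₄ + 2 * (∑ i, w i + u) = 0)
    (hw : ∀ i j, i ≠ j → σ (w i - w j) ≠ 0) (hu : ∀ i, σ (u - w i) ≠ 0) :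
    ∑ l, (∏ j ∈ univ.erase l, σ (w l + w j) / σ (w l - w j)) * (σ (w l + u) / σ (w l - u)) *
        (σ (w l + x₁) * σ (w l + x₂) * σ (w l + x₃) * σ (w l + x₄)) +
      (∏ j, σ (u + w j) / σ (u - w j)) *
        (σ (u + x₁) * σ (u + x₂) * σ (u + x₃) * σ (u + x₄)) =
      parityProd σ (n + 1) (∑ i, w i + u) x₁ x₂ x₃ x₄ := by
  have hne (x y : Fin n ⊕ Unit) (hxy : x ≠ y) :
      σ (Sum.elim w (fun _ => u) x - Sum.elim w (fun _ => u) y) ≠ 0 := by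
    rcases x with i | i <;> rcases y with j | j
    · exact hw i j fun h => hxy (congrArg _ h)
    · exact hσ.sub_ne_zero_comm.1 (hu i)
    · exact hu j
    · exact absurd rfl hxy
  have h := hσ.sum_prod_mul_div_eq (s := univ) (by simpa using hx) fun x _ y _ => hne x y
  simpa [univ_erase_inl, univ_erase_inr, prod_disjSum, -prod_div_distrib] using h

end IsSigma

theorem prod_Ioi_eq_mul {n : ℕ} (l : Fin n) {F G : Fin n → Fin n → ℂ} {R : Fin n → ℂ}
    (h : ∀ i j, i < j → F i j = G i j * ((if i = l then R j else 1) * if j = l then R i else 1)) :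
    ∏ i, ∏ j ∈ Ioi i, F i j = (∏ i, ∏ j ∈ Ioi i, G i j) * ∏ j ∈ univ.erase l, R j := by
  have left_eq : ∏ i, ∏ j ∈ Ioi i, (if i = l then R j else 1) = ∏ j ∈ Ioi l, R j := by
    rw [prod_eq_single l (fun i _ hi => by simp [hi]) (by simp)]
    simp
  have right_eq : ∏ i, ∏ j ∈ Ioi i, (if j = l then R i else 1) = ∏ i ∈ Iio l, R i := by
    simp only [prod_ite_eq', mem_Ioi]
    rw [← prod_filter]
    congr 1
    ext i
    simp
  have erase_eq : univ.erase l = Ioi l ∪ Iio l := by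
    ext i
    simp [lt_or_lt_iff_ne, ne_comm]
  have disjoint : Disjoint (Ioi l) (Iio l) :=
    disjoint_left.2 fun i hi hi' => lt_asymm (mem_Ioi.1 hi) (mem_Iio.1 hi')
  rw [erase_eq, prod_union disjoint, ← left_eq, ← right_eq]
  simp only [← prod_mul_distrib]
  exact prod_congr rfl fun i _ => prod_congr rfl fun j hj => h i j (mem_Ioi.1 hj)

theorem sum_add_single {n : ℕ} (x : Fin n → ℕ) (l : Fin n) :
    ∑ i, (x + Pi.single l 1 : Fin n → ℕ) i = ∑ i, x i + 1 := by
  simp [sum_add_distrib]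

theorem sum_indexSimplex_succ {n N : ℕ} (l : Fin n) (f : (Fin n → ℕ) → ℂ)
    (hf : ∀ x, x l = 0 → f x = 0) :
    ∑ x ∈ indexSimplex n (N + 1), f x = ∑ x ∈ indexSimplex n N, f (x + Pi.single l 1) := by
  symm
  refine sum_of_injOn (fun x => x + Pi.single l 1) (fun x _ y _ h => add_right_cancel h)
    (fun x hx => ?_) (fun x hx hx' => hf x (by_contra fun h0 => hx' ?_)) fun _ _ => rfl
  · rw [mem_coe, mem_indexSimplex] at *
    simpa only [sum_add_single, add_le_add_iff_right] using hx
  · have sub_add_cancel : x - Pi.single l 1 + Pi.single l 1 = x := by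
      refine tsub_add_cancel_of_le fun i => ?_
      rcases eq_or_ne i l with rfl | hi
      · simpa using Nat.one_le_iff_ne_zero.2 h0
      · simp [hi]
    refine ⟨x - Pi.single l 1, ?_, sub_add_cancel⟩
    rw [mem_indexSimplex, ← sub_add_cancel, sum_add_single] at hx
    exact mem_coe.2 (mem_indexSimplex.2 (Nat.le_of_succ_le_succ hx))

theorem sum_indexSimplex_succ_of_eq_zero {n N : ℕ} (f : (Fin n → ℕ) → ℂ)
    (hf : ∀ x, ∑ i, x i = N + 1 → f x = 0) :
    ∑ x ∈ indexSimplex n (N + 1), f x = ∑ x ∈ indexSimplex n N, f x := by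
  refine (sum_subset (fun x hx => ?_) fun x hx hx' => hf x ?_).symm <;>
    rw [mem_indexSimplex] at * <;> omega

/-- The shifted factorial `σ(u) σ(u + h) ⋯ σ(u + (k - 1) h)`, which is `(z)_k` in additive
notation. -/
def sigmaPoch (σ : ℂ → ℂ) (h u : ℂ) (k : ℕ) : ℂ := ∏ j ∈ range k, σ (u + j * h)

section SigmaPoch

variable {σ : ℂ → ℂ} {h u v : ℂ}

theorem sigmaPoch_succ (σ : ℂ → ℂ) (h u : ℂ) (k : ℕ) :
    sigmaPoch σ h u (k + 1) = sigmaPoch σ h u k * σ (u + k * h) := prod_range_succ _ _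

theorem sigmaPoch_succ_left (huv : u + h = v) (k : ℕ) :
    sigmaPoch σ h u (k + 1) = σ u * sigmaPoch σ h v k := by
  rw [sigmaPoch, prod_range_succ', mul_comm, sigmaPoch, ← huv]
  simp only [Nat.cast_add, Nat.cast_zero, Nat.cast_one, zero_mul, add_zero, add_mul, one_mul,
    add_assoc, add_comm h]

theorem sigmaPoch_mul (huv : u + h = v) (k : ℕ) :
    sigmaPoch σ h u k * σ (u + k * h) = σ u * sigmaPoch σ h v k := by
  rw [← sigmaPoch_succ, sigmaPoch_succ_left huv]

theorem sigmaPoch_eq_div (huv : u + h = v) {k : ℕ} (hk : σ (u + k * h) ≠ 0) :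
    sigmaPoch σ h u k = σ u * sigmaPoch σ h v k / σ (u + k * h) :=
  eq_div_of_mul_eq hk (sigmaPoch_mul huv k)

theorem prod_sigmaPoch_mul {ι : Type*} [Fintype ι] {u v : ι → ℂ} (huv : ∀ i, u i + h = v i)
    (k : ι → ℕ) : (∏ i, sigmaPoch σ h (u i) (k i)) * ∏ i, σ (u i + k i * h) =
      (∏ i, σ (u i)) * ∏ i, sigmaPoch σ h (v i) (k i) := by
  simp only [← prod_mul_distrib, sigmaPoch_mul (huv _)]

theorem prod_eq_mul_of_forall_ne {ι : Type*} [Fintype ι] {l : ι} {F G : ι → ℂ}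
    {s : ℂ} (hl : F l = G l * s) (h : ∀ i, i ≠ l → F i = G i) : ∏ i, F i = (∏ i, G i) * s := by
  classical
  rw [← mul_prod_erase _ _ (mem_univ l), ← mul_prod_erase univ G (mem_univ l), hl,
    prod_congr rfl fun i hi => h i (ne_of_mem_erase hi)]
  ring

theorem prod_sigmaPoch_add_single {ι : Type*} [Fintype ι] [DecidableEq ι] (σ : ℂ → ℂ) (h : ℂ)
    (u : ι → ℂ) (x : ι → ℕ) (l : ι) :
    ∏ i, sigmaPoch σ h (u i) ((x + Pi.single l 1 : ι → ℕ) i) =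
      (∏ i, sigmaPoch σ h (u i) (x i)) * σ (u l + x l * h) :=
  prod_eq_mul_of_forall_ne (l := l) (by simp [sigmaPoch_succ]) fun i hi => by simp [hi]

end SigmaPoch

/-! ### The recursion in `N` -/

/-- The parameters of the summation formula in additive notation, so that `q = exp h`,
`a q^N = exp α`, `e q^N = exp ε`, and `b`, `c`, `d`, `z_i` are the exponentials of the fields of
the same name. The base points of the parity dependent factors are `r`. Keeping `a q^N` and
`e q^N` fixed is what makes the recursion in `N` work. -/
structure JacksonParams (n : ℕ) where
  (h α ε b c d : ℂ)
  z : Fin n → ℂ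
  r : Fin 4 → ℂ

namespace JacksonParams

variable {n : ℕ}

/-- The shifted variables `z_i q^{x_i}` in additive notation. -/
def shift (A : JacksonParams n) (x : Fin n → ℕ) (i : Fin n) : ℂ := A.z i + x i * A.h

/-- The pole `e q^k` of the partial fraction identity used in the recursion, besides those at the
shifted variables and at `poleV`; here `k = |x|`. -/
def poleU (A : JacksonParams n) (N k : ℕ) : ℂ := A.ε + (k - N) * A.h

/-- The pole `e q^{-N} / a` of the partial fraction identity used in the recursion. -/
def poleV (A : JacksonParams n) (N : ℕ) : ℂ := A.ε - A.α - N * A.h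

/-- The zero `e q^{2k - N}` of the partial fraction identity used in the recursion, besides those
at the variables `z_i` and at `zeroT`. -/
def zeroS (A : JacksonParams n) (N k : ℕ) : ℂ := A.ε + 2 * (k - N) * A.h

/-- The zero `e / a` of the partial fraction identity used in the recursion. -/
def zeroT (A : JacksonParams n) : ℂ := A.ε - A.α

variable (σ : ℂ → ℂ)

/-- The factor `Δ(zq^x) / Δ(z)`. -/
noncomputable def delta (A : JacksonParams n) (x : Fin n → ℕ) : ℂ :=
  ∏ i, ∏ j ∈ Ioi i, σ (A.z j - A.z i + ((x j : ℂ) - x i) * A.h) / σ (A.z j - A.z i)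

/-- The factor `∏_{i < j} (z_i z_j)_{x_i + x_j}`. -/
noncomputable def pairs (A : JacksonParams n) (x : Fin n → ℕ) : ℂ :=
  ∏ i, ∏ j ∈ Ioi i, sigmaPoch σ A.h (A.z i + A.z j) (x i + x j)

/-- The factor `θ(a q^{2k}) (a, q^{-N})_k / (θ(a) (a q^{N + 1})_k)`, where `k = |x|`. -/
noncomputable def radial (A : JacksonParams n) (N k : ℕ) : ℂ :=
  σ (A.α + (2 * k - N) * A.h) / σ (A.α - N * A.h) *
    (sigmaPoch σ A.h (A.α - N * A.h) k * sigmaPoch σ A.h (-(N * A.h)) k /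
      sigmaPoch σ A.h (A.α + A.h) k)

/-- The factor `∏_i (e / z_i)_{|x|} / (e / z_i)_{|x| - x_i}`. -/
noncomputable def epsRatio (A : JacksonParams n) (N : ℕ) (x : Fin n → ℕ) : ℂ :=
  ∏ i, sigmaPoch σ A.h (A.ε - N * A.h - A.z i) (∑ j, x j) /
    sigmaPoch σ A.h (A.ε - N * A.h - A.z i) (∑ j, x j - x i)

/-- The factor `∏_i (b z_i, c z_i, d z_i)_{x_i}`. -/
noncomputable def numer (A : JacksonParams n) (x : Fin n → ℕ) : ℂ :=
  ∏ i, sigmaPoch σ A.h (A.b + A.z i) (x i) * sigmaPoch σ A.h (A.c + A.z i) (x i) *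
    sigmaPoch σ A.h (A.d + A.z i) (x i)

/-- The factor `∏_i (q^{-N} e z_i / a)_{x_i}`. -/
noncomputable def numerPole (A : JacksonParams n) (N : ℕ) (x : Fin n → ℕ) : ℂ :=
  ∏ i, sigmaPoch σ A.h (A.poleV N + A.z i) (x i)

/-- The factor `∏_i (a q z_i / e)_{x_i}`. -/
noncomputable def denomPole (A : JacksonParams n) (x : Fin n → ℕ) : ℂ :=
  ∏ i, sigmaPoch σ A.h (A.α - A.ε + A.h + A.z i) (x i)

/-- The factor `∏_{i,j} (q z_i / z_j)_{x_i}`. -/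
noncomputable def denom (A : JacksonParams n) (x : Fin n → ℕ) : ℂ :=
  ∏ i, ∏ j, sigmaPoch σ A.h (A.h + A.z i - A.z j) (x i)

/-- The parity dependent factor of the denominator, where `k = |x|`. -/
noncomputable def parityDenom (A : JacksonParams n) (N k : ℕ) : ℂ :=
  ∏ i, sigmaPoch σ A.h (A.r i - N * A.h) k

/-- The summand in additive notation. -/
noncomputable def summand (A : JacksonParams n) (N : ℕ) (x : Fin n → ℕ) : ℂ :=
  A.delta σ x * A.pairs σ x * A.radial σ N (∑ i, x i) * A.epsRatio σ N x *
    (A.numer σ x * A.numerPole σ N x / (A.denomPole σ x * A.denom σ x)) /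
    A.parityDenom σ N (∑ i, x i)

/-- The quotient of the closed forms for `N + 1` and `N`. -/
noncomputable def valueRatio (A : JacksonParams n) (N : ℕ) : ℂ :=
  σ (A.α - N * A.h) * (∏ i, σ (A.poleV (N + 1) + A.z i) / σ (A.poleV (N + 1) - A.z i)) *
    (σ (A.poleV (N + 1) + A.b) * σ (A.poleV (N + 1) + A.c) * σ (A.poleV (N + 1) + A.d)) /
    ∏ i, σ (A.r i - (N + 1) * A.h)

/-- Genericity of the parameters for sums over `|x| ≤ M`: no denominator met in the recursion
vanishes. -/
structure Generic (A : JacksonParams n) (M : ℕ) : Prop where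
  sub : ∀ i j, i ≠ j → ∀ l : ℤ, |l| ≤ M → σ (A.z i - A.z j + l * A.h) ≠ 0
  nat : ∀ l : ℕ, 1 ≤ l → l ≤ M → σ (l * A.h) ≠ 0
  alpha : ∀ l : ℤ, σ (A.α + l * A.h) ≠ 0
  eps_sub : ∀ i, ∀ l : ℤ, σ (A.ε - A.z i + l * A.h) ≠ 0
  pole_sub : ∀ i, ∀ l : ℤ, σ (A.ε - A.α - A.z i + l * A.h) ≠ 0
  pole_add : ∀ i, ∀ l : ℤ, σ (A.ε - A.α + A.z i + l * A.h) ≠ 0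
  parity : ∀ i, ∀ l : ℤ, σ (A.r i + l * A.h) ≠ 0

/-- The balancing condition, and the choice of the base points `r` for which the type `D` partial
fraction sum of the recursion is the parity dependent factor. -/
structure Balanced (A : JacksonParams n) : Prop where
  sum_eq : 2 * A.α + A.h = A.b + A.c + A.d + A.ε + 2 * ∑ i, A.z i
  parityProd_eq : ∀ N k : ℕ, parityProd σ (n + 1)
    (∑ i, A.z i + k * A.h + A.poleV (N + 1)) (A.h - A.zeroS (N + 1) (k + 1)) A.b A.c A.d =
      -∏ i, σ (A.r i + ((k : ℂ) - N - 1) * A.h)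

variable {σ} {A : JacksonParams n} {M : ℕ}

theorem le_sum (x : Fin n → ℕ) (i : Fin n) : x i ≤ ∑ j, x j :=
  single_le_sum (fun j _ => Nat.zero_le (x j)) (mem_univ i)

theorem Generic.alpha_ne (hA : A.Generic σ M) {u : ℂ} (l : ℤ) (hu : u = A.α + l * A.h) :
    σ u ≠ 0 := hu ▸ hA.alpha l

theorem Generic.eps_ne (hA : A.Generic σ M) {u : ℂ} (i : Fin n) (l : ℤ)
    (hu : u = A.ε - A.z i + l * A.h) : σ u ≠ 0 := hu ▸ hA.eps_sub i l

theorem Generic.shift_sub_add (hA : A.Generic σ M) {x : Fin n → ℕ} {i j : Fin n} (hij : i ≠ j)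
    (l : ℤ) (hl : |x i + l - x j| ≤ (M : ℤ)) : σ (A.shift x i + l * A.h - A.shift x j) ≠ 0 := by
  convert hA.sub i j hij (x i + l - x j) hl using 2
  simp only [shift]
  push_cast
  ring

theorem Generic.shift_sub (hA : A.Generic σ M) {x : Fin n → ℕ} (hx : ∑ i, x i ≤ M) {i j : Fin n}
    (hij : i ≠ j) : σ (A.shift x i - A.shift x j) ≠ 0 := by
  have hi := le_sum x i
  have hj := le_sum x j
  simpa using hA.shift_sub_add (x := x) hij 0 (by rw [abs_le]; omega)

theorem Generic.poleU_sub (hA : A.Generic σ M) (x : Fin n → ℕ) (N k : ℕ) (i : Fin n) :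
    σ (A.poleU N k - A.shift x i) ≠ 0 :=
  hA.eps_ne i (k - N - x i) (by simp only [shift, poleU]; push_cast; ring)

theorem Generic.poleV_sub (hA : A.Generic σ M) (x : Fin n → ℕ) (N : ℕ) (i : Fin n) :
    σ (A.poleV N - A.shift x i) ≠ 0 := by
  convert hA.pole_sub i (-(N : ℤ) - x i) using 2
  simp only [shift, poleV]
  push_cast
  ring

theorem Generic.poleV_add (hA : A.Generic σ M) (x : Fin n → ℕ) (N : ℕ) (i : Fin n) :
    σ (A.poleV N + A.shift x i) ≠ 0 := by
  convert hA.pole_add i (-(N : ℤ) + x i) using 2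
  simp only [shift, poleV]
  push_cast
  ring

theorem Generic.prod_parity_ne_zero (hA : A.Generic σ M) (l : ℤ) :
    ∏ i, σ (A.r i + l * A.h) ≠ 0 :=
  prod_ne_zero_iff.2 fun i _ => hA.parity i l

theorem shift_zero : A.shift 0 = A.z := by
  funext i
  simp [shift]

theorem sum_shift (x : Fin n → ℕ) :
    ∑ i, A.shift x i = ∑ i, A.z i + (∑ i, x i : ℕ) * A.h := by
  simp only [shift, sum_add_distrib, ← sum_mul, Nat.cast_sum]

theorem shift_add_single_self (x : Fin n → ℕ) (l : Fin n) :
    A.shift (x + Pi.single l 1) l = A.shift x l + A.h := by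
  simp only [shift, Pi.add_apply, Pi.single_eq_same]
  push_cast
  ring

theorem shift_add_single_of_ne (x : Fin n → ℕ) {l j : Fin n} (hj : j ≠ l) :
    A.shift (x + Pi.single l 1) j = A.shift x j := by
  simp [shift, hj]

theorem delta_zero (hA : A.Generic σ M) : A.delta σ 0 = 1 := by
  refine prod_eq_one fun i _ => prod_eq_one fun j hj => ?_
  have ne_zero := hA.shift_sub (x := 0) (by simp) (mem_Ioi.1 hj).ne'
  simp only [shift_zero] at ne_zero
  simp [ne_zero]

theorem delta_add_single (hσ : IsSigma σ) (hA : A.Generic σ M) {x : Fin n → ℕ}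
    (hx : ∑ i, x i ≤ M) (l : Fin n) :
    A.delta σ (x + Pi.single l 1) = A.delta σ x *
      ∏ j ∈ univ.erase l, σ (A.shift x l + A.h - A.shift x j) / σ (A.shift x l - A.shift x j) := by
  refine prod_Ioi_eq_mul l fun i j hij => ?_
  have shift_sub_shift (y : Fin n → ℕ) :
      A.z j - A.z i + ((y j : ℂ) - y i) * A.h = A.shift y j - A.shift y i := by
    simp only [shift]
    ring
  rw [shift_sub_shift, shift_sub_shift]
  rcases eq_or_ne i l with rfl | hi
  · rw [if_pos rfl, if_neg hij.ne', mul_one, shift_add_single_self,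
      shift_add_single_of_ne _ hij.ne', hσ.sub_comm (A.shift x j), hσ.sub_comm (A.shift x j)]
    have := hA.shift_sub hx hij.ne
    field_simp
  · rcases eq_or_ne j l with rfl | hj
    · rw [if_neg hi, if_pos rfl, one_mul, shift_add_single_self, shift_add_single_of_ne _ hi]
      have := hA.shift_sub hx hi.symm
      field_simp
    · rw [if_neg hi, if_neg hj, shift_add_single_of_ne _ hi, shift_add_single_of_ne _ hj]
      ring

theorem pairs_add_single (x : Fin n → ℕ) (l : Fin n) :
    A.pairs σ (x + Pi.single l 1) = A.pairs σ x *
      ∏ j ∈ univ.erase l, σ (A.shift x l + A.shift x j) := by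
  refine prod_Ioi_eq_mul l fun i j hij => ?_
  have shift_add_shift (i j : Fin n) :
      A.shift x i + A.shift x j = A.z i + A.z j + (x i + x j : ℕ) * A.h := by
    simp only [shift]
    push_cast
    ring
  rcases eq_or_ne i l with rfl | hi
  · rw [if_pos rfl, if_neg hij.ne', mul_one, shift_add_shift, ← sigmaPoch_succ]
    simp [hij.ne', add_right_comm]
  · rcases eq_or_ne j l with rfl | hj
    · rw [if_neg hi, if_pos rfl, one_mul, add_comm (A.shift x j), shift_add_shift,
        ← sigmaPoch_succ]
      simp [hi, add_assoc]
    · simp [hi, hj]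

theorem radial_zero (hA : A.Generic σ M) : A.radial σ 0 0 = 1 := by
  have ne_zero : σ A.α ≠ 0 := hA.alpha_ne 0 (by simp)
  simp [radial, sigmaPoch, ne_zero]

theorem radial_succ (hσ : IsSigma σ) (hA : A.Generic σ M) {N k : ℕ} (hN : N + 1 ≤ M)
    (hk : k ≤ N) :
    A.radial σ (N + 1) k = A.radial σ N k *
      (σ (A.α + (2 * k - N - 1) * A.h) / σ (A.α + (2 * k - N) * A.h)) *
      (σ (A.α - N * A.h) / σ (A.α + (k - N - 1) * A.h)) *
      (σ ((N + 1) * A.h) / σ ((N + 1 - k) * A.h)) := by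
  have top_ne : σ (A.α + (2 * k - N) * A.h) ≠ 0 := hA.alpha_ne (2 * k - N) (by push_cast; ring)
  have base_ne : σ (A.α - N * A.h) ≠ 0 := hA.alpha_ne (-N) (by push_cast; ring)
  have base_ne' : σ (A.α - (N + 1 : ℕ) * A.h) ≠ 0 := hA.alpha_ne (-N - 1) (by push_cast; ring)
  have alpha_eq : A.α - (N + 1 : ℕ) * A.h + k * A.h = A.α + (k - N - 1) * A.h := by
    push_cast
    ring
  have nat_eq : -((N + 1 : ℕ) * A.h) + k * A.h = -((N + 1 - k) * A.h) := by
    push_cast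
    ring
  have alpha_ne : σ (A.α + (k - N - 1) * A.h) ≠ 0 := hA.alpha_ne (k - N - 1) (by push_cast; ring)
  have nat_ne : σ ((N + 1 - k) * A.h) ≠ 0 := by
    convert hA.nat (N + 1 - k) (by omega) (by omega) using 3
    rw [Nat.cast_sub (by omega)]
    push_cast
    ring
  have top_eq : A.α + (2 * k - (N + 1 : ℕ)) * A.h = A.α + (2 * k - N - 1) * A.h := by
    push_cast
    ring
  rw [radial, sigmaPoch_eq_div (u := A.α - (N + 1 : ℕ) * A.h) (v := A.α - N * A.h)
      (by push_cast; ring) (by rwa [alpha_eq]), alpha_eq,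
    sigmaPoch_eq_div (u := -((N + 1 : ℕ) * A.h)) (v := -(N * A.h)) (by push_cast; ring)
      (by rwa [nat_eq, hσ.odd, neg_ne_zero]), nat_eq, hσ.odd, hσ.odd, top_eq, radial]
  push_cast at base_ne' ⊢
  generalize σ (A.α - (N + 1) * A.h) = base at base_ne' ⊢
  field_simp

theorem radial_succ_succ (hσ : IsSigma σ) (hA : A.Generic σ M) (N k : ℕ) :
    A.radial σ (N + 1) (k + 1) = -(A.radial σ N k *
      (σ (A.α + (2 * k - N + 1) * A.h) / σ (A.α + (2 * k - N) * A.h)) * σ (A.α - N * A.h) *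
      (σ ((N + 1) * A.h) / σ (A.α + (k + 1) * A.h))) := by
  have top_ne : σ (A.α + (2 * k - N) * A.h) ≠ 0 := hA.alpha_ne (2 * k - N) (by push_cast; ring)
  have base_ne : σ (A.α - N * A.h) ≠ 0 := hA.alpha_ne (-N) (by push_cast; ring)
  have base_ne' : σ (A.α - (N + 1 : ℕ) * A.h) ≠ 0 := hA.alpha_ne (-N - 1) (by push_cast; ring)
  have top_eq : A.α + (2 * (k + 1 : ℕ) - (N + 1 : ℕ)) * A.h = A.α + (2 * k - N + 1) * A.h := by
    push_cast
    ring
  have end_eq : A.α + A.h + k * A.h = A.α + (k + 1) * A.h := by ring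
  rw [radial, sigmaPoch_succ_left (u := A.α - (N + 1 : ℕ) * A.h) (v := A.α - N * A.h)
      (by push_cast; ring), sigmaPoch_succ_left (u := -((N + 1 : ℕ) * A.h)) (v := -(N * A.h))
      (by push_cast; ring), hσ.odd, sigmaPoch_succ, top_eq, end_eq, radial]
  push_cast at base_ne' ⊢
  generalize σ (A.α - (N + 1) * A.h) = base at base_ne' ⊢
  field_simp

theorem epsRatio_succ (hA : A.Generic σ M) (N : ℕ) (x : Fin n → ℕ) :
    A.epsRatio σ (N + 1) x = A.epsRatio σ N x *
      ((∏ i, σ (A.poleU (N + 1) (∑ i, x i) - A.shift x i)) /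
        ∏ i, σ (A.poleU (N + 1) (∑ i, x i) - A.z i)) := by
  simp only [epsRatio, ← prod_div_distrib, ← prod_mul_distrib]
  refine prod_congr rfl fun i _ => ?_
  have step : A.ε - (N + 1 : ℕ) * A.h - A.z i + A.h = A.ε - N * A.h - A.z i := by
    push_cast
    ring
  have base_ne : σ (A.ε - (N + 1 : ℕ) * A.h - A.z i) ≠ 0 :=
    hA.eps_ne i (-N - 1) (by push_cast; ring)
  have num_eq : A.ε - (N + 1 : ℕ) * A.h - A.z i + (∑ j, x j : ℕ) * A.h =
      A.poleU (N + 1) (∑ j, x j) - A.z i := by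
    simp only [poleU]
    ring
  have den_eq : A.ε - (N + 1 : ℕ) * A.h - A.z i + (∑ j, x j - x i : ℕ) * A.h =
      A.poleU (N + 1) (∑ j, x j) - A.shift x i := by
    rw [Nat.cast_sub (le_sum x i)]
    simp only [poleU, shift]
    ring
  have num_ne : σ (A.poleU (N + 1) (∑ j, x j) - A.z i) ≠ 0 := by
    simpa only [shift_zero] using hA.poleU_sub 0 (N + 1) (∑ j, x j) i
  rw [sigmaPoch_eq_div step (by rwa [num_eq]), sigmaPoch_eq_div step
    (by rw [den_eq]; exact hA.poleU_sub x _ _ i), num_eq, den_eq]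
  field_simp

theorem epsRatio_succ_add_single (hA : A.Generic σ M) (N : ℕ) (x : Fin n → ℕ) (l : Fin n) :
    A.epsRatio σ (N + 1) (x + Pi.single l 1) = A.epsRatio σ N x *
      σ (A.poleU (N + 1) (∑ i, x i) - A.shift x l) := by
  have step (i : Fin n) : A.ε - (N + 1 : ℕ) * A.h - A.z i + A.h = A.ε - N * A.h - A.z i := by
    push_cast
    ring
  have base_ne (i : Fin n) : σ (A.ε - (N + 1 : ℕ) * A.h - A.z i) ≠ 0 :=
    hA.eps_ne i (-N - 1) (by push_cast; ring)
  have den_eq : A.ε - (N + 1 : ℕ) * A.h - A.z l + (∑ j, x j - x l : ℕ) * A.h =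
      A.poleU (N + 1) (∑ j, x j) - A.shift x l := by
    rw [Nat.cast_sub (le_sum x l)]
    simp only [poleU, shift]
    ring
  refine prod_eq_mul_of_forall_ne (l := l) ?_ fun i hi => ?_
  · rw [sum_add_single, Pi.add_apply, Pi.single_eq_same, Nat.add_sub_add_right,
      sigmaPoch_succ_left (step l), sigmaPoch_eq_div (step l)
      (by rw [den_eq]; exact hA.poleU_sub x _ _ l), den_eq]
    have := hA.poleU_sub x (N + 1) (∑ j, x j) l
    have := base_ne l
    field_simp
  · rw [sum_add_single, Pi.add_apply, Pi.single_eq_of_ne hi, add_zero,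
      Nat.sub_add_comm (le_sum x i), sigmaPoch_succ_left (step i), sigmaPoch_succ_left (step i),
      mul_div_mul_left _ _ (base_ne i)]

theorem numer_add_single (x : Fin n → ℕ) (l : Fin n) :
    A.numer σ (x + Pi.single l 1) = A.numer σ x *
      (σ (A.shift x l + A.b) * σ (A.shift x l + A.c) * σ (A.shift x l + A.d)) := by
  have shift_add (b : ℂ) : A.shift x l + b = b + A.z l + x l * A.h := by
    simp only [shift]
    ring
  simp only [numer, prod_mul_distrib, prod_sigmaPoch_add_single, shift_add]
  ring

theorem numerPole_succ (hA : A.Generic σ M) (N : ℕ) (x : Fin n → ℕ) :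
    A.numerPole σ (N + 1) x = A.numerPole σ N x *
      ((∏ i, σ (A.poleV (N + 1) + A.z i)) / ∏ i, σ (A.poleV (N + 1) + A.shift x i)) := by
  have step (i : Fin n) : A.poleV (N + 1) + A.z i + A.h = A.poleV N + A.z i := by
    simp only [poleV]
    push_cast
    ring
  rw [← mul_div_assoc, mul_comm (A.numerPole σ N x)]
  refine eq_div_of_mul_eq (prod_ne_zero_iff.2 fun i _ => hA.poleV_add x _ i) ?_
  simpa only [numerPole, shift, add_assoc] using prod_sigmaPoch_mul (σ := σ) step x

theorem numerPole_succ_add_single (hA : A.Generic σ M) (N : ℕ) (x : Fin n → ℕ) (l : Fin n) :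
    A.numerPole σ (N + 1) (x + Pi.single l 1) = A.numerPole σ N x *
      ((∏ i, σ (A.poleV (N + 1) + A.z i)) /
        ∏ j ∈ univ.erase l, σ (A.poleV (N + 1) + A.shift x j)) := by
  have single_eq : A.numerPole σ (N + 1) (x + Pi.single l 1) =
      A.numerPole σ (N + 1) x * σ (A.poleV (N + 1) + A.shift x l) := by
    simp only [numerPole, prod_sigmaPoch_add_single, shift, add_assoc]
  have ne_zero := hA.poleV_add x (N + 1) l
  rw [single_eq, numerPole_succ hA,
    ← mul_prod_erase univ (fun j => σ (A.poleV (N + 1) + A.shift x j)) (mem_univ l)]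
  field_simp

theorem denomPole_add_single (x : Fin n → ℕ) (l : Fin n) :
    A.denomPole σ (x + Pi.single l 1) = A.denomPole σ x *
      σ (A.shift x l + A.h - A.zeroT) := by
  rw [denomPole, prod_sigmaPoch_add_single, denomPole]
  congr 2
  simp only [shift, zeroT]
  ring

theorem denom_add_single (x : Fin n → ℕ) (l : Fin n) :
    A.denom σ (x + Pi.single l 1) = A.denom σ x *
      ∏ j, σ (A.shift x l + A.h - A.z j) := by
  refine prod_eq_mul_of_forall_ne (l := l) ?_ fun i hi => by simp [hi]
  rw [← prod_mul_distrib]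
  refine prod_congr rfl fun j _ => ?_
  rw [Pi.add_apply, Pi.single_eq_same, sigmaPoch_succ]
  congr 2
  simp only [shift]
  ring

theorem parityDenom_succ (hA : A.Generic σ M) (N k : ℕ) :
    A.parityDenom σ (N + 1) k = A.parityDenom σ N k *
      ((∏ i, σ (A.r i - (N + 1) * A.h)) / ∏ i, σ (A.r i + ((k : ℂ) - N - 1) * A.h)) := by
  have step (i : Fin 4) : A.r i - (N + 1) * A.h + A.h = A.r i - N * A.h := by ring
  have end_eq (i : Fin 4) :
      A.r i + ((k : ℂ) - N - 1) * A.h = A.r i - (N + 1) * A.h + k * A.h := by ring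
  have ne_zero := hA.prod_parity_ne_zero (k - N - 1)
  push_cast at ne_zero
  rw [← mul_div_assoc, mul_comm (A.parityDenom σ N k)]
  refine eq_div_of_mul_eq ne_zero ?_
  simp only [parityDenom, Nat.cast_add, Nat.cast_one, end_eq]
  exact prod_sigmaPoch_mul step fun _ => k

theorem parityDenom_succ_succ (N k : ℕ) :
    A.parityDenom σ (N + 1) (k + 1) = A.parityDenom σ N k * ∏ i, σ (A.r i - (N + 1) * A.h) := by
  simp only [parityDenom, ← prod_mul_distrib]
  refine prod_congr rfl fun i _ => ?_
  rw [sigmaPoch_succ_left (v := A.r i - N * A.h) (by push_cast; ring), mul_comm]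
  push_cast
  rfl

end JacksonParams

namespace JacksonParams

variable {n : ℕ} (σ : ℂ → ℂ) (A : JacksonParams n)

/-- The term at the pole `A.shift x l` in the partial fraction identity used in the recursion. -/
noncomputable def fracTerm (N : ℕ) (x : Fin n → ℕ) (l : Fin n) : ℂ :=
  (∏ j, σ (A.shift x l - A.z j)) * (σ (A.shift x l - A.zeroS N (∑ i, x i)) *
    σ (A.shift x l - A.zeroT)) /
    ((∏ j ∈ univ.erase l, σ (A.shift x l - A.shift x j)) *
      (σ (A.shift x l - A.poleU N (∑ i, x i)) * σ (A.shift x l - A.poleV N)))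

/-- The term at the pole `poleU` in the partial fraction identity used in the recursion. -/
noncomputable def fracTermU (N : ℕ) (x : Fin n → ℕ) : ℂ :=
  (∏ j, σ (A.poleU N (∑ i, x i) - A.z j)) *
    (σ (A.poleU N (∑ i, x i) - A.zeroS N (∑ i, x i)) * σ (A.poleU N (∑ i, x i) - A.zeroT)) /
    ((∏ j, σ (A.poleU N (∑ i, x i) - A.shift x j)) * σ (A.poleU N (∑ i, x i) - A.poleV N))

/-- The term at the pole `poleV` in the partial fraction identity used in the recursion. -/
noncomputable def fracTermV (N : ℕ) (x : Fin n → ℕ) : ℂ :=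
  (∏ j, σ (A.poleV N - A.z j)) * (σ (A.poleV N - A.zeroS N (∑ i, x i)) *
    σ (A.poleV N - A.zeroT)) /
    ((∏ j, σ (A.poleV N - A.shift x j)) * σ (A.poleV N - A.poleU N (∑ i, x i)))

/-- The part common to all nodes of the coefficient that the summand at `x` acquires in the
recursion. -/
noncomputable def stepFactor (N : ℕ) (x : Fin n → ℕ) : ℂ :=
  σ (A.α - N * A.h) / σ (A.α + (2 * (∑ i, x i : ℕ) - N) * A.h) *
    ((∏ i, σ (A.poleV (N + 1) - A.shift x i)) * (∏ i, σ (A.poleV (N + 1) + A.z i)) /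
      ((∏ i, σ (A.poleV (N + 1) - A.z i)) * ∏ i, σ (A.poleV (N + 1) + A.shift x i))) /
    ∏ i, σ (A.r i - (N + 1) * A.h)

/-- The four factors at the node `u` of the type `D` partial fraction sum to which the coefficient
of a summand in the recursion reduces; here `k = |x|`. -/
noncomputable def stepQuad (N k : ℕ) (u : ℂ) : ℂ :=
  σ (u + (A.h - A.zeroS (N + 1) (k + 1))) * σ (u + A.b) * σ (u + A.c) * σ (u + A.d)

variable {σ A} {M : ℕ}

theorem Generic.prod_poleV_sub_ne_zero (hA : A.Generic σ M) (N : ℕ) (x : Fin n → ℕ) :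
    ∏ i, σ (A.poleV N - A.shift x i) ≠ 0 :=
  prod_ne_zero_iff.2 fun i _ => hA.poleV_sub x N i

theorem Generic.prod_poleV_sub_z_ne_zero (hA : A.Generic σ M) (N : ℕ) :
    ∏ i, σ (A.poleV N - A.z i) ≠ 0 := by
  simpa only [shift_zero] using hA.prod_poleV_sub_ne_zero N 0

theorem Generic.prod_poleV_add_ne_zero (hA : A.Generic σ M) (N : ℕ) (x : Fin n → ℕ) :
    ∏ i, σ (A.poleV N + A.shift x i) ≠ 0 :=
  prod_ne_zero_iff.2 fun i _ => hA.poleV_add x N i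

theorem poleV_sub_poleU (hσ : IsSigma σ) (N k : ℕ) :
    σ (A.poleV N - A.poleU N k) = -σ (A.α + k * A.h) := by
  rw [hσ.sub_comm]
  congr 2
  simp only [poleU, poleV]
  ring

theorem neg_fracTermV (hσ : IsSigma σ) (N : ℕ) (x : Fin n → ℕ) :
    -A.fracTermV σ N x = (∏ i, σ (A.poleV N - A.z i)) / (∏ i, σ (A.poleV N - A.shift x i)) *
      (σ (A.α + (2 * (∑ i, x i : ℕ) - N) * A.h) * σ (N * A.h) /
        σ (A.α + (∑ i, x i : ℕ) * A.h)) := by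
  have sub_zeroS : σ (A.poleV N - A.zeroS N (∑ i, x i)) =
      -σ (A.α + (2 * (∑ i, x i : ℕ) - N) * A.h) := by
    rw [hσ.sub_comm]
    congr 2
    simp only [zeroS, poleV]
    ring
  have sub_zeroT : σ (A.poleV N - A.zeroT) = -σ (N * A.h) := by
    rw [hσ.sub_comm]
    congr 2
    simp only [zeroT, poleV]
    ring
  rw [fracTermV, sub_zeroS, sub_zeroT, poleV_sub_poleU hσ, neg_mul_neg, mul_neg, div_neg, neg_neg,
    mul_div_mul_comm]

theorem fracTermV_ne_zero (hσ : IsSigma σ) (hA : A.Generic σ M) {N : ℕ} (hN : N ≤ M)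
    (hN0 : 1 ≤ N) (x : Fin n → ℕ) : A.fracTermV σ N x ≠ 0 := by
  rw [← neg_ne_zero, neg_fracTermV hσ]
  have top_ne : σ (A.α + (2 * (∑ i, x i : ℕ) - N) * A.h) ≠ 0 :=
    hA.alpha_ne (2 * (∑ i, x i : ℕ) - N) (by push_cast; ring)
  exact mul_ne_zero
    (div_ne_zero (hA.prod_poleV_sub_z_ne_zero N) (hA.prod_poleV_sub_ne_zero N x))
    (div_ne_zero (mul_ne_zero top_ne (hA.nat N hN0 hN))
      (hA.alpha_ne (∑ i, x i : ℕ) (by push_cast; ring)))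

theorem sum_fracTerm (hσ : IsSigma σ) (hA : A.Generic σ M) {N : ℕ} (hN : N ≤ M)
    (hN0 : 1 ≤ N) {x : Fin n → ℕ} (hx : ∑ i, x i ≤ N) :
    ∑ l, A.fracTerm σ N x l / -A.fracTermV σ N x + A.fracTermU σ N x / -A.fracTermV σ N x = 1 := by
  have sum_eq : ∑ i, A.shift x i + (A.poleU N (∑ i, x i) + A.poleV N) =
      ∑ i, A.z i + (A.zeroS N (∑ i, x i) + A.zeroT) := by
    rw [sum_shift]
    simp only [poleU, poleV, zeroS, zeroT]
    ring
  have poleU_sub_poleV : σ (A.poleU N (∑ i, x i) - A.poleV N) ≠ 0 := by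
    rw [hσ.sub_ne_zero_comm, poleV_sub_poleU hσ, neg_ne_zero]
    exact hA.alpha_ne (∑ i, x i : ℕ) (by push_cast; ring)
  have partial_fractions := hσ.sum_prod_div_add_add_eq_zero (A.shift x) A.z sum_eq
    (fun i j hij => hA.shift_sub (hx.trans hN) hij) (hA.poleU_sub x N _) (hA.poleV_sub x N)
    poleU_sub_poleV
  rw [← sum_div, ← add_div, div_eq_one_iff_eq (neg_ne_zero.2 (fracTermV_ne_zero hσ hA hN hN0 x)),
    eq_neg_iff_add_eq_zero, add_assoc]
  exact partial_fractions

theorem fracTerm_eq_zero (hσ : IsSigma σ) {N : ℕ} {x : Fin n → ℕ} {l : Fin n} (hl : x l = 0) :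
    A.fracTerm σ N x l = 0 := by
  have prod_eq_zero : ∏ j, σ (A.shift x l - A.z j) = 0 :=
    prod_eq_zero (mem_univ l) (by simp [shift, hl, hσ.zero])
  rw [fracTerm, prod_eq_zero, zero_mul, zero_div]

theorem fracTermU_eq_zero (hσ : IsSigma σ) {N : ℕ} {x : Fin n → ℕ} (hx : ∑ i, x i = N) :
    A.fracTermU σ N x = 0 := by
  have factor_eq_zero : σ (A.poleU N (∑ i, x i) - A.zeroS N (∑ i, x i)) = 0 := by
    simp [poleU, zeroS, hx, hσ.zero]
  rw [fracTermU, factor_eq_zero, zero_mul, mul_zero, zero_div]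

theorem fracTermU_div (hσ : IsSigma σ) (hA : A.Generic σ M) (N : ℕ) (x : Fin n → ℕ) :
    A.fracTermU σ (N + 1) x / -A.fracTermV σ (N + 1) x =
      (∏ i, σ (A.poleU (N + 1) (∑ i, x i) - A.z i)) /
          (∏ i, σ (A.poleU (N + 1) (∑ i, x i) - A.shift x i)) *
        ((∏ i, σ (A.poleV (N + 1) - A.shift x i)) / ∏ i, σ (A.poleV (N + 1) - A.z i)) *
        (σ ((N + 1 - (∑ i, x i : ℕ)) * A.h) * σ (A.α + ((∑ i, x i : ℕ) - N - 1) * A.h) /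
          (σ (A.α + (2 * (∑ i, x i : ℕ) - N - 1) * A.h) * σ ((N + 1) * A.h))) := by
  rw [neg_fracTermV hσ, fracTermU]
  generalize ∑ i, x i = k
  have sub_zeroS : A.poleU (N + 1) k - A.zeroS (N + 1) k = (N + 1 - k) * A.h := by
    simp only [poleU, zeroS]
    push_cast
    ring
  have sub_zeroT : A.poleU (N + 1) k - A.zeroT = A.α + (k - N - 1) * A.h := by
    simp only [poleU, zeroT]
    push_cast
    ring
  have top_eq : A.α + (2 * k - (N + 1 : ℕ)) * A.h = A.α + (2 * k - N - 1) * A.h := by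
    push_cast
    ring
  have alpha_ne : σ (A.α + k * A.h) ≠ 0 := hA.alpha_ne k (by push_cast; ring)
  rw [hσ.sub_comm (A.poleU (N + 1) k) (A.poleV (N + 1)), poleV_sub_poleU hσ, neg_neg, sub_zeroS,
    sub_zeroT, top_eq, Nat.cast_add_one]
  generalize σ (A.α + k * A.h) = alpha at alpha_ne ⊢
  field_simp

theorem fracTerm_div (hσ : IsSigma σ) (hA : A.Generic σ M) (N : ℕ) (x : Fin n → ℕ) (l : Fin n) :
    A.fracTerm σ (N + 1) (x + Pi.single l 1) l / -A.fracTermV σ (N + 1) (x + Pi.single l 1) =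
      (∏ j, σ (A.shift x l + A.h - A.z j)) /
          (∏ j ∈ univ.erase l, σ (A.shift x l + A.h - A.shift x j)) *
        ((∏ j ∈ univ.erase l, σ (A.poleV (N + 1) - A.shift x j)) /
          ∏ i, σ (A.poleV (N + 1) - A.z i)) *
        (σ (A.shift x l + A.h - A.zeroS (N + 1) (∑ i, x i + 1)) *
          σ (A.shift x l + A.h - A.zeroT) * σ (A.α + ((∑ i, x i : ℕ) + 1) * A.h) /
          (σ (A.poleU (N + 1) (∑ i, x i) - A.shift x l) *
            σ (A.α + (2 * (∑ i, x i : ℕ) - N + 1) * A.h) * σ ((N + 1) * A.h))) := by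
  have shift_of_mem {j : Fin n} (hj : j ∈ univ.erase l) :
      A.shift (x + Pi.single l 1) j = A.shift x j :=
    shift_add_single_of_ne x (ne_of_mem_erase hj)
  have prod_shift_sub : ∏ j ∈ univ.erase l, σ (A.shift x l + A.h - A.shift (x + Pi.single l 1) j) =
      ∏ j ∈ univ.erase l, σ (A.shift x l + A.h - A.shift x j) :=
    prod_congr rfl fun j hj => by rw [shift_of_mem hj]
  have prod_poleV_sub : ∏ j, σ (A.poleV (N + 1) - A.shift (x + Pi.single l 1) j) =
      σ (A.poleV (N + 1) - (A.shift x l + A.h)) *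
        ∏ j ∈ univ.erase l, σ (A.poleV (N + 1) - A.shift x j) := by
    rw [← mul_prod_erase _ _ (mem_univ l), shift_add_single_self]
    exact congrArg _ (prod_congr rfl fun j hj => by rw [shift_of_mem hj])
  have sub_poleV_ne : σ (A.poleV (N + 1) - (A.shift x l + A.h)) ≠ 0 := by
    have := hA.poleV_sub (x + Pi.single l 1) (N + 1) l
    rwa [shift_add_single_self] at this
  rw [neg_fracTermV hσ, fracTerm, prod_poleV_sub, shift_add_single_self, prod_shift_sub,
    sum_add_single]
  generalize ∑ i, x i = k
  have sub_poleU : σ (A.shift x l + A.h - A.poleU (N + 1) (k + 1)) =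
      -σ (A.poleU (N + 1) k - A.shift x l) := by
    rw [hσ.sub_comm]
    congr 2
    simp only [poleU]
    push_cast
    ring
  have top_eq : A.α + (2 * (k + 1 : ℕ) - (N + 1 : ℕ)) * A.h = A.α + (2 * k - N + 1) * A.h := by
    push_cast
    ring
  have alpha_ne : σ (A.α + (k + 1) * A.h) ≠ 0 := hA.alpha_ne (k + 1) (by push_cast; ring)
  rw [sub_poleU, hσ.sub_comm (A.shift x l + A.h) (A.poleV (N + 1)), top_eq, Nat.cast_add_one,
    Nat.cast_add_one]
  generalize σ (A.α + (k + 1) * A.h) = alpha,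
    σ (A.poleV (N + 1) - (A.shift x l + A.h)) = subPoleV at alpha_ne sub_poleV_ne ⊢
  field_simp

theorem valueRatio_eq (hσ : IsSigma σ) (hA : A.Generic σ M) (N : ℕ) (x : Fin n → ℕ) :
    A.valueRatio σ N = -(A.stepFactor σ N x * ((∏ j, σ (A.poleV (N + 1) + A.shift x j) /
      σ (A.poleV (N + 1) - A.shift x j)) *
        A.stepQuad σ N (∑ i, x i) (A.poleV (N + 1)))) := by
  have := hA.prod_poleV_sub_ne_zero (N + 1) x
  have := hA.prod_poleV_add_ne_zero (N + 1) x
  have top_ne : σ (A.α + (2 * (∑ i, x i : ℕ) - N) * A.h) ≠ 0 :=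
    hA.alpha_ne (2 * (∑ i, x i : ℕ) - N) (by push_cast; ring)
  have poleV_add : σ (A.poleV (N + 1) + (A.h - A.zeroS (N + 1) (∑ i, x i + 1))) =
      -σ (A.α + (2 * (∑ i, x i : ℕ) - N) * A.h) := by
    rw [← hσ.odd]
    congr 1
    simp only [poleV, zeroS]
    push_cast
    ring
  rw [valueRatio, stepFactor, stepQuad, prod_div_distrib, prod_div_distrib, poleV_add]
  generalize σ (A.α + (2 * (∑ i, x i : ℕ) - N) * A.h) = top at top_ne ⊢
  field_simp

theorem fracTermU_div_mul_radial (hσ : IsSigma σ) (hA : A.Generic σ M) {N : ℕ} (hN : N + 1 ≤ M)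
    {x : Fin n → ℕ} (hx : ∑ i, x i ≤ N) :
    A.fracTermU σ (N + 1) x / -A.fracTermV σ (N + 1) x *
        (A.radial σ (N + 1) (∑ i, x i) * A.epsRatio σ (N + 1) x) =
      A.radial σ N (∑ i, x i) * A.epsRatio σ N x *
        (σ (A.α - N * A.h) / σ (A.α + (2 * (∑ i, x i : ℕ) - N) * A.h) *
          ((∏ i, σ (A.poleV (N + 1) - A.shift x i)) / ∏ i, σ (A.poleV (N + 1) - A.z i))) := by
  have alpha_ne : σ (A.α + ((∑ i, x i : ℕ) - N - 1) * A.h) ≠ 0 :=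
    hA.alpha_ne ((∑ i, x i : ℕ) - N - 1) (by push_cast; ring)
  have top_ne : σ (A.α + (2 * (∑ i, x i : ℕ) - N - 1) * A.h) ≠ 0 :=
    hA.alpha_ne (2 * (∑ i, x i : ℕ) - N - 1) (by push_cast; ring)
  have nat_ne : σ ((N + 1) * A.h) ≠ 0 := mod_cast hA.nat (N + 1) (by omega) hN
  have nat_sub_ne : σ ((N + 1 - (∑ i, x i : ℕ)) * A.h) ≠ 0 := by
    convert hA.nat (N + 1 - ∑ i, x i) (by omega) (by omega) using 3
    rw [Nat.cast_sub (by omega), Nat.cast_add_one]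
  have poleU_ne : ∏ i, σ (A.poleU (N + 1) (∑ i, x i) - A.shift x i) ≠ 0 :=
    prod_ne_zero_iff.2 fun i _ => hA.poleU_sub x _ _ i
  have poleU_z_ne : ∏ i, σ (A.poleU (N + 1) (∑ i, x i) - A.z i) ≠ 0 :=
    prod_ne_zero_iff.2 fun i _ => by
      simpa only [shift_zero] using hA.poleU_sub 0 (N + 1) (∑ i, x i) i
  rw [fracTermU_div hσ hA, radial_succ hσ hA hN hx, epsRatio_succ hA]
  generalize σ (A.α + ((∑ i, x i : ℕ) - N - 1) * A.h) = alpha,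
    σ (A.α + (2 * (∑ i, x i : ℕ) - N - 1) * A.h) = top, σ ((N + 1) * A.h) = nat,
    σ ((N + 1 - (∑ i, x i : ℕ)) * A.h) = natSub,
    ∏ i, σ (A.poleU (N + 1) (∑ i, x i) - A.shift x i) = prodPoleU,
    ∏ i, σ (A.poleU (N + 1) (∑ i, x i) - A.z i) = prodPoleUZ
    at alpha_ne top_ne nat_ne nat_sub_ne poleU_ne poleU_z_ne ⊢
  field_simp

theorem fracTermU_mul_summand (hσ : IsSigma σ) (hA : A.Generic σ M) {N : ℕ} (hN : N + 1 ≤ M)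
    {x : Fin n → ℕ} (hx : ∑ i, x i ≤ N) :
    A.fracTermU σ (N + 1) x / -A.fracTermV σ (N + 1) x * A.summand σ (N + 1) x =
      A.summand σ N x * (A.stepFactor σ N x *
        ∏ i, σ (A.r i + ((∑ i, x i : ℕ) - N - 1 : ℂ) * A.h)) := by
  calc
    _ = A.fracTermU σ (N + 1) x / -A.fracTermV σ (N + 1) x *
          (A.radial σ (N + 1) (∑ i, x i) * A.epsRatio σ (N + 1) x) *
        (A.delta σ x * A.pairs σ x *
          (A.numer σ x * A.numerPole σ (N + 1) x / (A.denomPole σ x * A.denom σ x)) /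
          A.parityDenom σ (N + 1) (∑ i, x i)) := by
      rw [summand]
      ring
    _ = _ := by
      rw [fracTermU_div_mul_radial hσ hA hN hx, numerPole_succ hA, parityDenom_succ hA, summand,
        stepFactor]
      simp only [div_eq_mul_inv, mul_inv, inv_inv]
      ring

theorem Generic.prod_shift_add_sub_ne_zero (hA : A.Generic σ M) {x : Fin n → ℕ}
    (hx : ∑ i, x i + 1 ≤ M) (l : Fin n) :
    ∏ j ∈ univ.erase l, σ (A.shift x l + A.h - A.shift x j) ≠ 0 := by
  refine prod_ne_zero_iff.2 fun j hj => ?_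
  have hl := le_sum x l
  have hj' := le_sum x j
  simpa only [Int.cast_one, one_mul] using
    hA.shift_sub_add (ne_of_mem_erase hj).symm 1 (by rw [abs_le]; omega)

theorem Generic.prod_shift_add_sub_z_ne_zero (hA : A.Generic σ M) {x : Fin n → ℕ}
    (hx : ∑ i, x i + 1 ≤ M) (l : Fin n) : ∏ j, σ (A.shift x l + A.h - A.z j) ≠ 0 := by
  refine prod_ne_zero_iff.2 fun j _ => ?_
  have hl := le_sum x l
  have shift_eq : A.shift x l + A.h - A.z j = A.z l - A.z j + ((x l + 1 : ℕ) : ℤ) * A.h := by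
    simp only [shift]
    push_cast
    ring
  rw [shift_eq]
  rcases eq_or_ne l j with rfl | hj
  · simpa only [sub_self, zero_add, Int.cast_natCast] using
      hA.nat (x l + 1) (by omega) (by omega)
  · exact hA.sub l j hj _ (by rw [abs_le]; omega)

theorem fracTerm_div_mul_radial (hσ : IsSigma σ) (hA : A.Generic σ M) {N : ℕ} (hN : N + 1 ≤ M)
    {x : Fin n → ℕ} (hx : ∑ i, x i ≤ N) (l : Fin n) :
    A.fracTerm σ (N + 1) (x + Pi.single l 1) l / -A.fracTermV σ (N + 1) (x + Pi.single l 1) *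
        (A.delta σ (x + Pi.single l 1) * (A.radial σ (N + 1) (∑ i, x i + 1) *
          A.epsRatio σ (N + 1) (x + Pi.single l 1)) /
          (A.denomPole σ (x + Pi.single l 1) * A.denom σ (x + Pi.single l 1))) =
      -(A.delta σ x * (A.radial σ N (∑ i, x i) * A.epsRatio σ N x) /
          (A.denomPole σ x * A.denom σ x) *
        (σ (A.α - N * A.h) / σ (A.α + (2 * (∑ i, x i : ℕ) - N) * A.h)) *
        ((∏ j ∈ univ.erase l, σ (A.poleV (N + 1) - A.shift x j)) /
          ((∏ i, σ (A.poleV (N + 1) - A.z i)) *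
            ∏ j ∈ univ.erase l, σ (A.shift x l - A.shift x j))) *
        σ (A.shift x l + A.h - A.zeroS (N + 1) (∑ i, x i + 1))) := by
  have top_ne : σ (A.α + (2 * (∑ i, x i : ℕ) - N + 1) * A.h) ≠ 0 :=
    hA.alpha_ne (2 * (∑ i, x i : ℕ) - N + 1) (by push_cast; ring)
  have alpha_ne : σ (A.α + ((∑ i, x i : ℕ) + 1) * A.h) ≠ 0 :=
    hA.alpha_ne ((∑ i, x i : ℕ) + 1) (by push_cast; ring)
  have nat_ne : σ ((N + 1) * A.h) ≠ 0 := mod_cast hA.nat (N + 1) (by omega) hN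
  have poleU_ne := hA.poleU_sub x (N + 1) (∑ i, x i) l
  have zeroT_ne : σ (A.shift x l + A.h - A.zeroT) ≠ 0 := by
    rw [hσ.sub_ne_zero_comm]
    convert hA.pole_sub l (-(x l : ℤ) - 1) using 2
    simp only [shift, zeroT]
    push_cast
    ring
  have shift_ne := hA.prod_shift_add_sub_ne_zero (x := x) (by omega) l
  have shift_z_ne := hA.prod_shift_add_sub_z_ne_zero (x := x) (by omega) l
  rw [fracTerm_div hσ hA, delta_add_single hσ hA (by omega), radial_succ_succ hσ hA,
    epsRatio_succ_add_single hA, denomPole_add_single, denom_add_single, prod_div_distrib]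
  refine Eq.trans ?_ (mul_div_cancel_right₀ _ (mul_ne_zero (mul_ne_zero (mul_ne_zero top_ne
    alpha_ne) (mul_ne_zero nat_ne poleU_ne)) (mul_ne_zero (mul_ne_zero zeroT_ne shift_ne)
    shift_z_ne)))
  ring

theorem fracTerm_mul_summand (hσ : IsSigma σ) (hA : A.Generic σ M) {N : ℕ} (hN : N + 1 ≤ M)
    {x : Fin n → ℕ} (hx : ∑ i, x i ≤ N) (l : Fin n) :
    A.fracTerm σ (N + 1) (x + Pi.single l 1) l / -A.fracTermV σ (N + 1) (x + Pi.single l 1) *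
        A.summand σ (N + 1) (x + Pi.single l 1) =
      A.summand σ N x * (A.stepFactor σ N x *
        ((∏ j ∈ univ.erase l, σ (A.shift x l + A.shift x j) / σ (A.shift x l - A.shift x j)) *
          (σ (A.shift x l + A.poleV (N + 1)) / σ (A.shift x l - A.poleV (N + 1))) *
          A.stepQuad σ N (∑ i, x i) (A.shift x l))) := by
  have sub_ne := hA.poleV_sub x (N + 1) l
  have add_ne := hA.poleV_add x (N + 1) l
  calc
    _ = A.fracTerm σ (N + 1) (x + Pi.single l 1) l /
          -A.fracTermV σ (N + 1) (x + Pi.single l 1) *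
          (A.delta σ (x + Pi.single l 1) * (A.radial σ (N + 1) (∑ i, x i + 1) *
            A.epsRatio σ (N + 1) (x + Pi.single l 1)) /
            (A.denomPole σ (x + Pi.single l 1) * A.denom σ (x + Pi.single l 1))) *
        (A.pairs σ (x + Pi.single l 1) *
          (A.numer σ (x + Pi.single l 1) * A.numerPole σ (N + 1) (x + Pi.single l 1)) /
          A.parityDenom σ (N + 1) (∑ i, x i + 1)) := by
      rw [summand, sum_add_single]
      ring
    _ = _ := by
      rw [fracTerm_div_mul_radial hσ hA hN hx, pairs_add_single, numer_add_single,
        numerPole_succ_add_single hA, parityDenom_succ_succ, summand, stepFactor, stepQuad,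
        ← mul_prod_erase univ (fun i => σ (A.poleV (N + 1) - A.shift x i)) (mem_univ l),
        ← mul_prod_erase univ (fun i => σ (A.poleV (N + 1) + A.shift x i)) (mem_univ l),
        prod_div_distrib, hσ.sub_comm (A.shift x l) (A.poleV (N + 1)),
        add_comm (A.shift x l) (A.poleV (N + 1)), ← add_sub_assoc]
      refine (mul_div_cancel_right₀ _ (mul_ne_zero sub_ne add_ne)).symm.trans ?_
      ring

theorem sum_summand_zero (hA : A.Generic σ M) : ∑ x ∈ indexSimplex n 0, A.summand σ 0 x = 1 := by
  have indexSimplex_zero : indexSimplex n 0 = {0} := by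
    ext x
    simp [mem_indexSimplex, funext_iff]
  rw [indexSimplex_zero, sum_singleton, summand, delta_zero hA]
  simp [radial_zero hA, pairs, epsRatio, numer, numerPole, denomPole, denom, parityDenom,
    sigmaPoch]

theorem stepFactor_mul_add_eq_valueRatio (hσ : IsSigma σ) (hA : A.Generic σ M)
    (hA' : A.Balanced σ) {N : ℕ} {x : Fin n → ℕ} (hx : ∑ i, x i ≤ M) :
    ∑ l, A.stepFactor σ N x *
        ((∏ j ∈ univ.erase l, σ (A.shift x l + A.shift x j) / σ (A.shift x l - A.shift x j)) *
          (σ (A.shift x l + A.poleV (N + 1)) / σ (A.shift x l - A.poleV (N + 1))) *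
          A.stepQuad σ N (∑ i, x i) (A.shift x l)) +
      A.stepFactor σ N x * ∏ i, σ (A.r i + ((∑ i, x i : ℕ) - N - 1 : ℂ) * A.h) =
    A.valueRatio σ N := by
  have sum_eq : A.h - A.zeroS (N + 1) (∑ i, x i + 1) + A.b + A.c + A.d +
      2 * (∑ i, A.shift x i + A.poleV (N + 1)) = 0 := by
    rw [sum_shift]
    simp only [poleV, zeroS]
    push_cast
    linear_combination -hA'.sum_eq
  have partial_fractions := hσ.sum_prod_mul_div_add_eq (A.shift x) sum_eq
    (fun i j hij => hA.shift_sub hx hij) (hA.poleV_sub x (N + 1))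
  rw [sum_shift, hA'.parityProd_eq] at partial_fractions
  rw [valueRatio_eq hσ hA N x, ← mul_sum]
  simp only [stepQuad]
  linear_combination A.stepFactor σ N x * partial_fractions

theorem sum_summand_succ (hσ : IsSigma σ) (hA : A.Generic σ M) (hA' : A.Balanced σ) {N : ℕ}
    (hN : N + 1 ≤ M) :
    ∑ x ∈ indexSimplex n (N + 1), A.summand σ (N + 1) x =
      (∑ x ∈ indexSimplex n N, A.summand σ N x) * A.valueRatio σ N := by
  calc
    _ = ∑ l, ∑ x ∈ indexSimplex n (N + 1), A.fracTerm σ (N + 1) x l / -A.fracTermV σ (N + 1) x *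
          A.summand σ (N + 1) x + ∑ x ∈ indexSimplex n (N + 1),
          A.fracTermU σ (N + 1) x / -A.fracTermV σ (N + 1) x * A.summand σ (N + 1) x := by
      rw [sum_comm, ← sum_add_distrib]
      refine sum_congr rfl fun x hx => ?_
      rw [← sum_mul, ← add_mul, sum_fracTerm hσ hA hN (by omega) (mem_indexSimplex.1 hx), one_mul]
    _ = ∑ x ∈ indexSimplex n N, (∑ l, A.fracTerm σ (N + 1) (x + Pi.single l 1) l /
          -A.fracTermV σ (N + 1) (x + Pi.single l 1) * A.summand σ (N + 1) (x + Pi.single l 1) +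
          A.fracTermU σ (N + 1) x / -A.fracTermV σ (N + 1) x * A.summand σ (N + 1) x) := by
      rw [sum_indexSimplex_succ_of_eq_zero _ fun x hx => by
          rw [fracTermU_eq_zero hσ hx, zero_div, zero_mul],
        sum_congr rfl fun l _ => sum_indexSimplex_succ l _ fun x hx => by
          rw [fracTerm_eq_zero hσ hx, zero_div, zero_mul],
        sum_comm, ← sum_add_distrib]
    _ = _ := by
      rw [sum_mul]
      refine sum_congr rfl fun x hx => ?_
      rw [mem_indexSimplex] at hx
      rw [sum_congr rfl fun l _ => fracTerm_mul_summand hσ hA hN hx l,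
        fracTermU_mul_summand hσ hA hN hx, ← mul_sum, ← mul_add,
        stepFactor_mul_add_eq_valueRatio hσ hA hA' (by omega)]

theorem sum_summand_eq (hσ : IsSigma σ) (hA : A.Generic σ M) (hA' : A.Balanced σ) {N : ℕ}
    (hN : N ≤ M) :
    ∑ x ∈ indexSimplex n N, A.summand σ N x = ∏ j ∈ range N, A.valueRatio σ j := by
  induction N with
  | zero => rw [sum_summand_zero hA, prod_range_zero]
  | succ N ih => rw [sum_summand_succ hσ hA hA' hN, ih (by omega), prod_range_succ]

end JacksonParams

/-! ### Multiplicative notation -/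

namespace JacksonParams

variable {n : ℕ}

/-- The base points of the parity dependent factors; here `ζ = z_1 + ⋯ + z_n`. -/
def parityArgs (n : ℕ) (h α ε b c d ζ : ℂ) : Fin 4 → ℂ :=
  if Odd n then ![ε + ζ - α, α + h - b - ζ, α + h - c - ζ, α + h - d - ζ]
  else ![α + h - ζ, α + h - c - d - ζ, α + h - b - d - ζ, α + h - b - c - ζ]

/-- The relations between the parameters of the summation formula, in additive notation. -/
structure Compatible (A : JacksonParams n) : Prop where
  sum_eq : 2 * A.α + A.h = A.b + A.c + A.d + A.ε + 2 * ∑ i, A.z i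
  r_eq : A.r = parityArgs n A.h A.α A.ε A.b A.c A.d (∑ i, A.z i)

variable {A : JacksonParams n}

theorem Compatible.balanced {σ : ℂ → ℂ} (hσ : IsSigma σ) (hA : A.Compatible) : A.Balanced σ := by
  refine ⟨hA.sum_eq, fun N k => ?_⟩
  have sum_eq := hA.sum_eq
  rw [hA.r_eq, Fin.prod_univ_four, parityProd, parityArgs]
  set W := ∑ i, A.z i + k * A.h + A.poleV (N + 1) with W_def
  set v := A.h - A.zeroS (N + 1) (k + 1) with v_def
  simp only [poleV, zeroS] at W_def v_def
  push_cast at W_def v_def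
  rcases Nat.even_or_odd n with hn | hn
  · rw [if_pos hn.add_one, if_neg (Nat.not_odd_iff_even.2 hn)]
    simp only [Matrix.cons_val]
    have W_add_v : W + v = -(A.α + A.h - ∑ i, A.z i + ((k : ℂ) - N - 1) * A.h) := by
      linear_combination W_def + v_def
    have W_add {b c d : ℂ} (hb : b + c + d = A.b + A.c + A.d) :
        W + b = A.α + A.h - c - d - ∑ i, A.z i + ((k : ℂ) - N - 1) * A.h := by
      linear_combination W_def + hb - sum_eq
    rw [W_add_v, W_add (b := A.b) rfl, W_add (b := A.c) (c := A.b) (d := A.d) (by ring),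
      W_add (b := A.d) (c := A.b) (d := A.c) (by ring), hσ.odd]
    ring
  · rw [if_neg (Nat.not_odd_iff_even.2 hn.add_one), if_pos hn]
    simp only [Matrix.cons_val]
    have W_eq : W = A.ε + ∑ i, A.z i - A.α + ((k : ℂ) - N - 1) * A.h := by
      linear_combination W_def
    have W_add_v_add (b : ℂ) :
        W + v + b = -(A.α + A.h - b - ∑ i, A.z i + ((k : ℂ) - N - 1) * A.h) := by
      linear_combination W_def + v_def
    rw [W_add_v_add, W_add_v_add, W_add_v_add, W_eq, hσ.odd, hσ.odd, hσ.odd]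
    ring

theorem Compatible.sum_r (hA : A.Compatible) : ∑ i, A.r i = 2 * A.h + 2 * A.ε := by
  rw [hA.r_eq, Fin.sum_univ_four, parityArgs]
  split_ifs
  · simp only [Matrix.cons_val]
    linear_combination hA.sum_eq
  · simp only [Matrix.cons_val]
    linear_combination 2 * hA.sum_eq

end JacksonParams

/-- The logarithm of the quotient of `ellPoch` and `sigmaPoch`. -/
noncomputable def pochExponent (h u k : ℂ) : ℂ := (k * u + h * (k * (k - 1) / 2)) / 2

theorem pochExponent_add_left (h u v k : ℂ) :
    pochExponent h (u + v) k = pochExponent h v k + k * (u / 2) := by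
  simp only [pochExponent]
  ring

theorem sum_Ioi_add {n : ℕ} (f : Fin n → ℂ) :
    ∑ i, ∑ j ∈ Ioi i, (f i + f j) = (n - 1) * ∑ i, f i := by
  rw [sum_sum_Ioi_add_eq_sum_sum_off_diag fun _ i => f i, mul_sum]
  refine sum_congr rfl fun i _ => ?_
  rw [sum_const, card_compl, card_singleton, Fintype.card_fin, nsmul_eq_mul,
    Nat.cast_sub (by have := i.pos; omega), Nat.cast_one]

theorem sum_Ioi_pochExponent_add (h : ℂ) {n : ℕ} (z x : Fin n → ℂ) :
    ∑ i, ∑ j ∈ Ioi i, pochExponent h (z i + z j) (x i + x j) =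
      (n - 2) * ∑ i, pochExponent h (z i) (x i) + pochExponent h (∑ i, z i) (∑ i, x i) := by
  -- `half i j + half j i` is the bilinear part of `pochExponent h (z i + z j) (x i + x j)`.
  let half (i j : Fin n) : ℂ := (x i * z j + h * (x i * x j) / 2) / 2
  have pochExponent_add (i j : Fin n) : pochExponent h (z i + z j) (x i + x j) =
      pochExponent h (z i) (x i) + pochExponent h (z j) (x j) + (half j i + half i j) := by
    simp only [pochExponent, half]
    ring
  have half_self (i : Fin n) : half i i = pochExponent h (z i) (x i) + h / 4 * x i := by
    simp only [pochExponent, half]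
    ring
  have sum_half : ∑ i, ∑ j, half j i =
      ((∑ i, x i) * (∑ i, z i) + h * ((∑ i, x i) * ∑ i, x i) / 2) / 2 := by
    rw [sum_comm]
    simp only [half, add_div, sum_add_distrib, ← sum_div, ← mul_sum, ← sum_mul]
  have sum_half_compl : ∑ i, ∑ j ∈ {i}ᶜ, half j i =
      ∑ i, ∑ j, half j i - ∑ i, (pochExponent h (z i) (x i) + h / 4 * x i) := by
    rw [← sum_sub_distrib]
    refine sum_congr rfl fun i _ => ?_
    rw [Fintype.sum_eq_add_sum_compl i, half_self, add_sub_cancel_left]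
  calc
    _ = (n - 1) * ∑ i, pochExponent h (z i) (x i) + ∑ i, ∑ j ∈ {i}ᶜ, half j i := by
      rw [← sum_sum_Ioi_add_eq_sum_sum_off_diag, ← sum_Ioi_add]
      simp only [pochExponent_add, sum_add_distrib]
    _ = _ := by
      rw [sum_half_compl, sum_half, sum_add_distrib, ← mul_sum, pochExponent]
      ring

theorem ellPoch_exp (p h u : ℂ) (k : ℕ) : ellPoch p (Complex.exp h) (Complex.exp u) k =
    Complex.exp (pochExponent h u k) * sigmaPoch (thetaSigma p) h u k := by
  induction k with
  | zero => simp [ellPoch, sigmaPoch, pochExponent]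
  | succ k ih =>
    rw [ellPoch, prod_range_succ, ← ellPoch, ih, sigmaPoch_succ, ← Complex.exp_nat_mul,
      ← Complex.exp_add, ellTheta_exp, add_comm (k * h) u, mul_mul_mul_comm, ← Complex.exp_add]
    congr 2
    simp only [pochExponent]
    push_cast
    ring

theorem exp_mul_mul_exp_mul (s t x y : ℂ) : Complex.exp s * x * (Complex.exp t * y) =
    Complex.exp (s + t) * (x * y) := by
  rw [mul_mul_mul_comm, ← Complex.exp_add]

theorem exp_mul_div_exp_mul (s t x y : ℂ) : Complex.exp s * x / (Complex.exp t * y) =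
    Complex.exp (s - t) * (x / y) := by
  rw [mul_div_mul_comm, ← Complex.exp_sub]

theorem exp_mul_of_eq_zero {s : ℂ} (hs : s = 0) (x : ℂ) : Complex.exp s * x = x := by
  rw [hs, Complex.exp_zero, one_mul]

theorem exp_mul_exp_pow (k : ℕ) (h u : ℂ) :
    Complex.exp u * Complex.exp h ^ k = Complex.exp (u + k * h) := by
  rw [← Complex.exp_nat_mul, Complex.exp_add]

theorem exp_zpow_neg_natCast (h : ℂ) (N : ℕ) :
    Complex.exp h ^ (-(N : ℤ)) = Complex.exp (-(N * h)) := by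
  rw [← Complex.exp_int_mul, Int.cast_neg, Int.cast_natCast, neg_mul]

theorem prod_exp_mul {ι : Type*} {s : Finset ι} {F f G : ι → ℂ}
    (h : ∀ i ∈ s, F i = Complex.exp (f i) * G i) :
    ∏ i ∈ s, F i = Complex.exp (∑ i ∈ s, f i) * ∏ i ∈ s, G i := by
  rw [Complex.exp_sum, ← prod_mul_distrib]
  exact prod_congr rfl h

theorem prod_ellPoch_exp_add (p h β : ℂ) {n : ℕ} (z : Fin n → ℂ) (x : Fin n → ℕ) :
    ∏ i, ellPoch p (Complex.exp h) (Complex.exp (β + z i)) (x i) =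
      Complex.exp (∑ i, pochExponent h (z i) (x i) + (∑ i, x i : ℕ) * (β / 2)) *
        ∏ i, sigmaPoch (thetaSigma p) h (β + z i) (x i) := by
  rw [Nat.cast_sum, sum_mul, ← sum_add_distrib]
  exact prod_exp_mul fun i _ => by rw [ellPoch_exp, pochExponent_add_left]

namespace JacksonParams

variable {n : ℕ} (A : JacksonParams n) (p : ℂ)

theorem ellDelta_exp (x : Fin n → ℕ) :
    ellDelta p (Complex.exp A.h) (fun i => Complex.exp (A.z i)) x =
      Complex.exp ((n - 1) * ((∑ i, x i : ℕ) * (A.h / 2))) * A.delta (thetaSigma p) x := by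
  rw [Nat.cast_sum, sum_mul, ← sum_Ioi_add]
  refine prod_exp_mul fun i _ => prod_exp_mul fun j _ => ?_
  have theta_arg : Complex.exp A.h ^ ((x j : ℤ) - x i) * Complex.exp (A.z j - A.z i) =
      Complex.exp (A.z j - A.z i + ((x j : ℂ) - x i) * A.h) := by
    rw [← Complex.exp_int_mul, ← Complex.exp_add, add_comm]
    push_cast
    rfl
  rw [← Complex.exp_sub, theta_arg, ← Complex.exp_nat_mul, ellTheta_exp, ellTheta_exp, ← mul_assoc,
    ← Complex.exp_add, exp_mul_div_exp_mul]
  congr 2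
  ring

theorem pairs_exp (x : Fin n → ℕ) :
    ∏ i, ∏ j ∈ Ioi i, ellPoch p (Complex.exp A.h) (Complex.exp (A.z i) * Complex.exp (A.z j))
        (x i + x j) =
      Complex.exp ((n - 2) * ∑ i, pochExponent A.h (A.z i) (x i) +
        pochExponent A.h (∑ i, A.z i) (∑ i, x i : ℕ)) * A.pairs (thetaSigma p) x := by
  rw [Nat.cast_sum, ← sum_Ioi_pochExponent_add]
  refine prod_exp_mul fun i _ => prod_exp_mul fun j _ => ?_
  rw [← Complex.exp_add, ellPoch_exp, Nat.cast_add]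

theorem radial_exp (N k : ℕ) :
    ellTheta p (Complex.exp (A.α - N * A.h) * Complex.exp A.h ^ (2 * k)) /
        ellTheta p (Complex.exp (A.α - N * A.h)) *
      (ellPoch p (Complex.exp A.h) (Complex.exp (A.α - N * A.h)) k *
        ellPoch p (Complex.exp A.h) (Complex.exp A.h ^ (-(N : ℤ))) k /
          ellPoch p (Complex.exp A.h) (Complex.exp (A.α - N * A.h) * Complex.exp A.h ^ (N + 1)) k) =
      Complex.exp (k * A.h + (pochExponent A.h (A.α - N * A.h) k +
        pochExponent A.h (-(N * A.h)) k - pochExponent A.h (A.α + A.h) k)) *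
        A.radial (thetaSigma p) N k := by
  rw [exp_mul_exp_pow, exp_mul_exp_pow, exp_zpow_neg_natCast,
    show A.α - N * A.h + (2 * k : ℕ) * A.h = A.α + (2 * k - N) * A.h by push_cast; ring,
    show A.α - N * A.h + (N + 1 : ℕ) * A.h = A.α + A.h by push_cast; ring, ellTheta_exp,
    ellTheta_exp, ellPoch_exp, ellPoch_exp, ellPoch_exp, exp_mul_mul_exp_mul, exp_mul_div_exp_mul,
    exp_mul_div_exp_mul, exp_mul_mul_exp_mul, radial]
  congr 3
  ring

theorem epsRatio_exp (N : ℕ) (x : Fin n → ℕ) :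
    (∏ i, ellPoch p (Complex.exp A.h) (Complex.exp (A.ε - N * A.h) / Complex.exp (A.z i))
        (∑ j, x j)) /
      ∏ i, ellPoch p (Complex.exp A.h) (Complex.exp (A.ε - N * A.h) / Complex.exp (A.z i))
        (∑ j, x j - x i) =
      Complex.exp ((∑ i, x i : ℕ) * ((A.ε - N * A.h + A.h * ((∑ i, x i : ℕ) - 1)) / 2) -
        ∑ i, pochExponent A.h (A.z i) (x i)) * A.epsRatio (thetaSigma p) N x := by
  rw [← prod_div_distrib]
  conv_rhs => rw [Nat.cast_sum, sum_mul, ← Nat.cast_sum, ← sum_sub_distrib]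
  refine prod_exp_mul fun i _ => ?_
  rw [← Complex.exp_sub, ellPoch_exp, ellPoch_exp, exp_mul_div_exp_mul, Nat.cast_sub (le_sum x i)]
  congr 2
  simp only [pochExponent]
  ring

theorem numer_exp (x : Fin n → ℕ) :
    (∏ i, ellPoch p (Complex.exp A.h) (Complex.exp A.b * Complex.exp (A.z i)) (x i)) *
      (∏ i, ellPoch p (Complex.exp A.h) (Complex.exp A.c * Complex.exp (A.z i)) (x i)) *
      (∏ i, ellPoch p (Complex.exp A.h) (Complex.exp A.d * Complex.exp (A.z i)) (x i)) =
    Complex.exp (3 * ∑ i, pochExponent A.h (A.z i) (x i) +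
      (∑ i, x i : ℕ) * ((A.b + A.c + A.d) / 2)) * A.numer (thetaSigma p) x := by
  simp only [← Complex.exp_add]
  rw [prod_ellPoch_exp_add, prod_ellPoch_exp_add, prod_ellPoch_exp_add, exp_mul_mul_exp_mul,
    exp_mul_mul_exp_mul, numer, prod_mul_distrib, prod_mul_distrib]
  congr 2
  ring

theorem numerPole_exp (N : ℕ) (x : Fin n → ℕ) :
    ∏ i, ellPoch p (Complex.exp A.h) (Complex.exp A.h ^ (-(N : ℤ)) *
        Complex.exp (A.ε - N * A.h) * Complex.exp (A.z i) / Complex.exp (A.α - N * A.h)) (x i) =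
      Complex.exp (∑ i, pochExponent A.h (A.z i) (x i) + (∑ i, x i : ℕ) * (A.poleV N / 2)) *
        A.numerPole (thetaSigma p) N x := by
  rw [numerPole, ← prod_ellPoch_exp_add]
  refine prod_congr rfl fun i _ => ?_
  rw [exp_zpow_neg_natCast, ← Complex.exp_add, ← Complex.exp_add, ← Complex.exp_sub, poleV]
  ring_nf

theorem denomPole_exp (N : ℕ) (x : Fin n → ℕ) :
    ∏ i, ellPoch p (Complex.exp A.h) (Complex.exp (A.α - N * A.h) * Complex.exp A.h *
        Complex.exp (A.z i) / Complex.exp (A.ε - N * A.h)) (x i) =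
      Complex.exp (∑ i, pochExponent A.h (A.z i) (x i) +
        (∑ i, x i : ℕ) * ((A.α - A.ε + A.h) / 2)) * A.denomPole (thetaSigma p) x := by
  rw [denomPole, ← prod_ellPoch_exp_add]
  refine prod_congr rfl fun i _ => ?_
  rw [← Complex.exp_add, ← Complex.exp_add, ← Complex.exp_sub]
  ring_nf

theorem denom_exp (x : Fin n → ℕ) :
    ∏ i, ∏ j, ellPoch p (Complex.exp A.h)
        (Complex.exp A.h * Complex.exp (A.z i) / Complex.exp (A.z j)) (x i) =
      Complex.exp (n * ∑ i, pochExponent A.h (A.z i) (x i) +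
        (∑ i, x i : ℕ) * ((n * A.h - ∑ i, A.z i) / 2)) * A.denom (thetaSigma p) x := by
  have sum_exponents : ∑ j, (∑ i, pochExponent A.h (A.z i) (x i) +
      (∑ i, x i : ℕ) * ((A.h - A.z j) / 2)) = n * ∑ i, pochExponent A.h (A.z i) (x i) +
        (∑ i, x i : ℕ) * ((n * A.h - ∑ i, A.z i) / 2) := by
    rw [sum_add_distrib, ← mul_sum, ← sum_div, sum_sub_distrib]
    simp only [sum_const, card_univ, Fintype.card_fin, nsmul_eq_mul]
  rw [← sum_exponents, denom, prod_comm, prod_comm (f := fun i j => sigmaPoch _ _ _ _)]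
  refine prod_exp_mul fun j _ => ?_
  simp only [← Complex.exp_add, ← Complex.exp_sub, add_sub_right_comm A.h]
  exact prod_ellPoch_exp_add p A.h (A.h - A.z j) A.z x

variable {A}

theorem parityDenom_exp (hA : A.Compatible) (N k : ℕ) :
    ∏ i, ellPoch p (Complex.exp A.h) (Complex.exp (A.r i - N * A.h)) k =
      Complex.exp (k * (A.h + A.ε - 2 * N * A.h + A.h * (k - 1))) *
        A.parityDenom (thetaSigma p) N k := by
  rw [prod_exp_mul fun i _ => ellPoch_exp p A.h (A.r i - N * A.h) k, parityDenom]
  congr 2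
  have sum_r := hA.sum_r
  rw [Fin.sum_univ_four] at sum_r ⊢
  simp only [pochExponent]
  linear_combination k / 2 * sum_r

theorem paritySummandFactor_eq (hA : A.Compatible) (N k : ℕ) :
    paritySummandFactor p (Complex.exp A.h) (Complex.exp (A.α - N * A.h)) (Complex.exp A.b)
        (Complex.exp A.c) (Complex.exp A.d) (Complex.exp (A.ε - N * A.h))
        (∏ i, Complex.exp (A.z i)) n N k =
      1 / ∏ i, ellPoch p (Complex.exp A.h) (Complex.exp (A.r i - N * A.h)) k := by
  rw [Fin.prod_univ_four, paritySummandFactor, hA.r_eq, parityArgs, ← Complex.exp_sum]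
  split_ifs <;>
    simp only [Matrix.cons_val, exp_zpow_neg_natCast, ← Complex.exp_add, ← Complex.exp_sub] <;>
    ring_nf

theorem jacksonSummand_exp (hA : A.Compatible) (N : ℕ) (x : Fin n → ℕ) :
    jacksonSummand p (Complex.exp A.h) (Complex.exp (A.α - N * A.h)) (Complex.exp A.b)
      (Complex.exp A.c) (Complex.exp A.d) (Complex.exp (A.ε - N * A.h))
      (fun i => Complex.exp (A.z i)) N x = A.summand (thetaSigma p) N x := by
  have regroup (δ τ π η μ ν ω γ κ β ρ δ' μ' θ : ℂ) :
      δ * τ * (π / η) * (μ * ν * ω / γ) * κ * (β * ρ / (δ' * μ')) * (1 / θ) =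
        κ * (δ * π * (τ * (μ * ν / γ)) * (ω / η) * (β * ρ / (δ' * μ')) / θ) := by
    ring
  rw [jacksonSummand, prod_div_distrib, prod_mul_distrib, prod_mul_distrib, prod_mul_distrib,
    prod_mul_distrib, paritySummandFactor_eq p hA, regroup, radial_exp, ellDelta_exp, pairs_exp,
    epsRatio_exp, numer_exp, numerPole_exp, denomPole_exp, denom_exp, parityDenom_exp p hA,
    ← Complex.exp_nat_mul]
  simp only [exp_mul_mul_exp_mul, exp_mul_div_exp_mul]
  rw [← mul_assoc, ← Complex.exp_add, summand]
  -- The exponents cancel because of the balancing condition.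
  refine exp_mul_of_eq_zero ?_ _
  generalize ∑ i, pochExponent A.h (A.z i) (x i) = P
  simp only [pochExponent, poleV]
  linear_combination (-((∑ i, x i : ℕ) : ℂ) / 2) * hA.sum_eq

end JacksonParams

theorem one_div_exp_mul (t y : ℂ) : 1 / (Complex.exp t * y) = Complex.exp (-t) * (1 / y) := by
  rw [Complex.exp_neg, one_div, mul_inv, one_div]

theorem exp_div_exp_mul (s t y : ℂ) :
    Complex.exp s / (Complex.exp t * y) = Complex.exp (s - t) * (1 / y) := by
  rw [← exp_mul_div_exp_mul, mul_one]

/-- The product `σ(u - h) σ(u - 2h) ⋯ σ(u - N h)`. -/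
def sigmaFall (σ : ℂ → ℂ) (h u : ℂ) (N : ℕ) : ℂ := ∏ j ∈ range N, σ (u - (j + 1) * h)

theorem sigmaPoch_sub_eq_sigmaFall (σ : ℂ → ℂ) (h u : ℂ) (N : ℕ) :
    sigmaPoch σ h (u - N * h) N = sigmaFall σ h u N := by
  rw [sigmaPoch, sigmaFall, ← prod_range_reflect]
  refine prod_congr rfl fun j hj => ?_
  have hjN : j + 1 ≤ N := mem_range.1 hj
  rw [Nat.sub_sub, add_comm 1 j, Nat.cast_sub hjN]
  congr 1
  push_cast
  ring

theorem IsSigma.sigmaPoch_sub_eq_sigmaFall {σ : ℂ → ℂ} (hσ : IsSigma σ) (h u : ℂ) (N : ℕ) :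
    sigmaPoch σ h (h - u) N = (-1) ^ N * sigmaFall σ h u N := by
  rw [sigmaPoch, sigmaFall, ← card_range N, ← prod_const, card_range, ← prod_mul_distrib]
  refine prod_congr rfl fun j _ => ?_
  rw [neg_one_mul, ← hσ.odd]
  congr 1
  ring

theorem ellPoch_exp_sub_nat_mul (p h u : ℂ) (N : ℕ) :
    ellPoch p (Complex.exp h) (Complex.exp (u - N * h)) N =
      Complex.exp (pochExponent h (u - N * h) N) * sigmaFall (thetaSigma p) h u N := by
  rw [ellPoch_exp, sigmaPoch_sub_eq_sigmaFall]

theorem ellPoch_exp_sub {p : ℂ} (hp : ‖p‖ < 1) (h u : ℂ) (N : ℕ) :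
    ellPoch p (Complex.exp h) (Complex.exp (h - u)) N =
      Complex.exp (pochExponent h (h - u) N) * ((-1) ^ N * sigmaFall (thetaSigma p) h u N) := by
  rw [ellPoch_exp, (isSigma_thetaSigma hp).sigmaPoch_sub_eq_sigmaFall]

namespace JacksonParams

variable {n : ℕ} {A : JacksonParams n} {p : ℂ}

theorem parityValueFactor_exp (hp : ‖p‖ < 1) (hA : A.Compatible) (N : ℕ) :
    parityValueFactor p (Complex.exp A.h) (Complex.exp (A.α - N * A.h)) (Complex.exp A.b)
        (Complex.exp A.c) (Complex.exp A.d) (Complex.exp (A.ε - N * A.h))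
        (∏ i, Complex.exp (A.z i)) n N =
      Complex.exp (N * ((A.b + A.c + A.d + 3 * A.ε - A.h) / 2 - 2 * A.α + 2 * ∑ i, A.z i) -
        A.h * N * (N + 1) / 2) * ((-1) ^ N / ∏ i, sigmaFall (thetaSigma p) A.h (A.r i) N) := by
  rw [hA.r_eq, parityArgs, parityValueFactor, ← Complex.exp_sum, Fin.prod_univ_four]
  split_ifs
  · have reverse_arg (b : ℂ) : A.α - N * A.h + A.h - (b + ∑ i, A.z i) =
        A.α + A.h - b - ∑ i, A.z i - N * A.h := by ring
    have reflect_arg : A.α - N * A.h + A.h - (A.ε - N * A.h + ∑ i, A.z i) =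
        A.h - (A.ε + ∑ i, A.z i - A.α) := by ring
    simp only [Matrix.cons_val, ← Complex.exp_add, ← Complex.exp_sub, ← Complex.exp_nat_mul]
    rw [reflect_arg, reverse_arg, reverse_arg, reverse_arg, ellPoch_exp_sub hp]
    simp only [ellPoch_exp_sub_nat_mul, exp_mul_mul_exp_mul, exp_div_exp_mul]
    refine congrArg₂ (Complex.exp · * ·) ?_ ?_
    · simp only [pochExponent]
      ring
    · rcases neg_one_pow_eq_or ℂ N with hN | hN <;> rw [hN] <;> ring
  · have reverse_arg : A.α - N * A.h + A.h - ∑ i, A.z i =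
        A.α + A.h - ∑ i, A.z i - N * A.h := by ring
    have reflect_arg {b c d : ℂ} (h : b + c + d = A.b + A.c + A.d) :
        A.α - N * A.h + A.h - (b + (A.ε - N * A.h) + ∑ i, A.z i) =
          A.h - (A.α + A.h - c - d - ∑ i, A.z i) := by
      linear_combination hA.sum_eq - h
    simp only [Matrix.cons_val, ← Complex.exp_add, ← Complex.exp_sub]
    rw [reverse_arg, reflect_arg (c := A.c) (d := A.d) rfl,
      reflect_arg (c := A.b) (d := A.d) (by ring), reflect_arg (c := A.b) (d := A.c) (by ring)]
    simp only [ellPoch_exp_sub_nat_mul, ellPoch_exp_sub hp, exp_mul_mul_exp_mul, one_div_exp_mul]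
    refine congrArg₂ (Complex.exp · * ·) ?_ ?_
    · simp only [pochExponent]
      linear_combination (3 * N / 2 : ℂ) * hA.sum_eq
    · rcases neg_one_pow_eq_or ℂ N with hN | hN <;> rw [hN] <;> ring

variable (A)

theorem prod_ellPoch_div_exp (hp : ‖p‖ < 1) (N : ℕ) :
    (∏ i, ellPoch p (Complex.exp A.h) (Complex.exp (A.α - N * A.h) * Complex.exp A.h /
        (Complex.exp (A.ε - N * A.h) * Complex.exp (A.z i))) N) /
      ∏ i, ellPoch p (Complex.exp A.h) (Complex.exp (A.α - N * A.h) * Complex.exp A.h *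
        Complex.exp (A.z i) / Complex.exp (A.ε - N * A.h)) N =
      Complex.exp (-(N * ∑ i, A.z i)) * ∏ i, sigmaFall (thetaSigma p) A.h (A.ε - A.α + A.z i) N /
        sigmaFall (thetaSigma p) A.h (A.ε - A.α - A.z i) N := by
  rw [← prod_div_distrib, mul_sum, ← sum_neg_distrib]
  refine prod_exp_mul fun i _ => ?_
  have numer_arg : A.α - N * A.h + A.h - (A.ε - N * A.h + A.z i) =
      A.h - (A.ε - A.α + A.z i) := by ring
  have denom_arg : A.α - N * A.h + A.h + A.z i - (A.ε - N * A.h) =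
      A.h - (A.ε - A.α - A.z i) := by ring
  simp only [← Complex.exp_add, ← Complex.exp_sub]
  rw [numer_arg, denom_arg, ellPoch_exp_sub hp, ellPoch_exp_sub hp, exp_mul_div_exp_mul,
    mul_div_mul_left _ _ (pow_ne_zero N (neg_ne_zero.2 one_ne_zero))]
  congr 2
  simp only [pochExponent]
  ring

theorem prod_valueRatio (σ : ℂ → ℂ) (N : ℕ) :
    ∏ j ∈ range N, A.valueRatio σ j =
      sigmaFall σ A.h (A.α + A.h) N *
        (∏ i, sigmaFall σ A.h (A.ε - A.α + A.z i) N / sigmaFall σ A.h (A.ε - A.α - A.z i) N) *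
        (sigmaFall σ A.h (A.ε - A.α + A.b) N * sigmaFall σ A.h (A.ε - A.α + A.c) N *
          sigmaFall σ A.h (A.ε - A.α + A.d) N) / ∏ i, sigmaFall σ A.h (A.r i) N := by
  have poleV_add (j : ℕ) (u : ℂ) : A.poleV (j + 1) + u = A.ε - A.α + u - (j + 1) * A.h := by
    simp only [poleV]
    push_cast
    ring
  have poleV_sub (j : ℕ) (u : ℂ) : A.poleV (j + 1) - u = A.ε - A.α - u - (j + 1) * A.h := by
    rw [sub_eq_add_neg, poleV_add, ← sub_eq_add_neg]
  have alpha_sub (j : ℕ) : A.α - j * A.h = A.α + A.h - (j + 1) * A.h := by ring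
  simp only [valueRatio, sigmaFall, poleV_add, poleV_sub, alpha_sub, prod_div_distrib,
    prod_mul_distrib]
  rw [prod_comm, prod_comm (s := range N) (t := univ), prod_comm (s := range N) (t := univ)]

variable {A}

theorem jacksonValue_exp (hp : ‖p‖ < 1) (hA : A.Compatible) (N : ℕ) :
    jacksonValue p (Complex.exp A.h) (Complex.exp (A.α - N * A.h)) (Complex.exp A.b)
      (Complex.exp A.c) (Complex.exp A.d) (Complex.exp (A.ε - N * A.h))
      (fun i => Complex.exp (A.z i)) N = ∏ j ∈ range N, A.valueRatio (thetaSigma p) j := by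
  have alpha_arg : A.α - N * A.h + A.h = A.α + A.h - N * A.h := by ring
  have numer_arg (b : ℂ) : A.α + A.h - N * A.h - (b + (A.ε - N * A.h)) =
      A.h - (A.ε - A.α + b) := by ring
  have regroup (α' β γ δ η η' ζ π : ℂ) : α' * β * γ * δ * η / (ζ * η') * π =
      ζ⁻¹ * (α' * β * γ * δ * (η / η') * π) := by ring
  rw [jacksonValue, regroup, prod_ellPoch_div_exp A hp, parityValueFactor_exp hp hA,
    ← Complex.exp_sum, ← Complex.exp_nat_mul, ← Complex.exp_neg, prod_valueRatio]
  simp only [← Complex.exp_add, ← Complex.exp_sub]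
  simp only [alpha_arg, numer_arg, ellPoch_exp_sub_nat_mul, ellPoch_exp_sub hp,
    exp_mul_mul_exp_mul]
  rw [← mul_assoc, ← Complex.exp_add, exp_mul_of_eq_zero]
  · rcases neg_one_pow_eq_or ℂ N with hN | hN <;> rw [hN] <;> ring
  · simp only [pochExponent]
    ring

end JacksonParams

/-- The multiplicative arguments of the parity dependent factors, up to powers of `q`. -/
noncomputable def parityRatios (n : ℕ) (a b c d e Z : ℂ) : Fin 4 → ℂ :=
  if Odd n then ![e * Z / a, a / (b * Z), a / (c * Z), a / (d * Z)]
  else ![a / Z, a / (c * d * Z), a / (b * d * Z), a / (b * c * Z)]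

theorem parityRatios_ne_zero {n : ℕ} {a b c d e Z : ℂ} (ha : a ≠ 0) (hb : b ≠ 0) (hc : c ≠ 0)
    (hd : d ≠ 0) (he : e ≠ 0) (hZ : Z ≠ 0) (i : Fin 4) : parityRatios n a b c d e Z i ≠ 0 := by
  rw [parityRatios]
  split_ifs <;> fin_cases i <;> simp [*]

/-- Genericity of the parameters that occur in the denominators: the multiplicative form of
`JacksonParams.Generic`, except for the conditions on `q` and on the quotients `z i / z j`. -/
structure ThetaGeneric (p q a b c d e : ℂ) {n : ℕ} (z : Fin n → ℂ) : Prop where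
  alpha : ∀ l : ℤ, ellTheta p (a * q ^ l) ≠ 0
  eps_div : ∀ i, ∀ l : ℤ, ellTheta p (e / z i * q ^ l) ≠ 0
  pole_div : ∀ i, ∀ l : ℤ, ellTheta p (e / (a * z i) * q ^ l) ≠ 0
  pole_mul : ∀ i, ∀ l : ℤ, ellTheta p (e * z i / a * q ^ l) ≠ 0
  parity : ∀ i, ∀ l : ℤ, ellTheta p (parityRatios n a b c d e (∏ i, z i) i * q ^ l) ≠ 0

namespace JacksonParams

variable {n : ℕ}

theorem exists_exp_eq {q a b c d e : ℂ} {z : Fin n → ℂ} {N : ℕ} (hq : q ≠ 0) (ha : a ≠ 0)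
    (hb : b ≠ 0) (hc : c ≠ 0) (he : e ≠ 0) (hz : ∀ i, z i ≠ 0)
    (hbal : a ^ 2 * q ^ (N + 1) = b * c * d * e * ∏ i, z i ^ 2) :
    ∃ A : JacksonParams n, A.Compatible ∧ Complex.exp A.h = q ∧
      Complex.exp (A.α - N * A.h) = a ∧ Complex.exp A.b = b ∧ Complex.exp A.c = c ∧
      Complex.exp A.d = d ∧ Complex.exp (A.ε - N * A.h) = e ∧
      (fun i => Complex.exp (A.z i)) = z := by
  obtain ⟨h, rfl⟩ : ∃ h, Complex.exp h = q := ⟨_, Complex.exp_log hq⟩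
  obtain ⟨α, rfl⟩ : ∃ α, Complex.exp (α - N * h) = a :=
    ⟨Complex.log a + N * h, by rw [add_sub_cancel_right, Complex.exp_log ha]⟩
  obtain ⟨ε, rfl⟩ : ∃ ε, Complex.exp (ε - N * h) = e :=
    ⟨Complex.log e + N * h, by rw [add_sub_cancel_right, Complex.exp_log he]⟩
  obtain ⟨b, rfl⟩ : ∃ b', Complex.exp b' = b := ⟨_, Complex.exp_log hb⟩
  obtain ⟨c, rfl⟩ : ∃ c', Complex.exp c' = c := ⟨_, Complex.exp_log hc⟩
  obtain ⟨z, rfl⟩ : ∃ z' : Fin n → ℂ, (fun i => Complex.exp (z' i)) = z :=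
    ⟨fun i => Complex.log (z i), funext fun i => Complex.exp_log (hz i)⟩
  -- The logarithm of `d` is prescribed by the balancing condition.
  let d' := 2 * α + h - b - c - ε - 2 * ∑ i, z i
  refine ⟨⟨h, α, ε, b, c, d', z, parityArgs n h α ε b c d' (∑ i, z i)⟩, ⟨by ring, rfl⟩,
    rfl, rfl, rfl, rfl, ?_, rfl, rfl⟩
  have exp_ne_zero := Complex.exp_ne_zero (b + c + (ε - N * h) + ∑ i, z i + ∑ i, z i)
  refine mul_left_cancel₀ exp_ne_zero ?_
  calc _ = Complex.exp (α - N * h) ^ 2 * Complex.exp h ^ (N + 1) := by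
        simp only [← Complex.exp_nat_mul, ← Complex.exp_add, d']
        push_cast
        ring_nf
    _ = _ := by
        simp only [hbal, prod_pow, Complex.exp_sum, Complex.exp_add]
        ring

theorem Compatible.exists_exp_r_eq {A : JacksonParams n} (hA : A.Compatible) (N : ℕ) (i : Fin 4) :
    ∃ m : ℤ, Complex.exp (A.r i) = parityRatios n (Complex.exp (A.α - N * A.h)) (Complex.exp A.b)
      (Complex.exp A.c) (Complex.exp A.d) (Complex.exp (A.ε - N * A.h))
      (∏ i, Complex.exp (A.z i)) i * Complex.exp A.h ^ m := by
  rw [hA.r_eq, parityArgs, parityRatios, ← Complex.exp_sum]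
  split_ifs <;> fin_cases i
  · refine ⟨0, ?_⟩
    simp only [Fin.reduceFinMk, Matrix.cons_val, ← Complex.exp_int_mul, ← Complex.exp_add,
      ← Complex.exp_sub]
    push_cast
    ring_nf
  all_goals
    refine ⟨N + 1, ?_⟩
    simp only [Fin.reduceFinMk, Matrix.cons_val, ← Complex.exp_int_mul, ← Complex.exp_add,
      ← Complex.exp_sub]
    push_cast
    ring_nf

theorem Compatible.generic {A : JacksonParams n} (hA : A.Compatible) {p : ℂ} {N : ℕ}
    (hsub : ∀ i j, i ≠ j → ∀ l : ℤ, |l| ≤ N →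
      ellTheta p (Complex.exp (A.z i) / Complex.exp (A.z j) * Complex.exp A.h ^ l) ≠ 0)
    (hnat : ∀ l : ℕ, 1 ≤ l → l ≤ N → ellTheta p (Complex.exp A.h ^ l) ≠ 0)
    (hgen : ThetaGeneric p (Complex.exp A.h) (Complex.exp (A.α - N * A.h)) (Complex.exp A.b)
      (Complex.exp A.c) (Complex.exp A.d) (Complex.exp (A.ε - N * A.h))
      fun i => Complex.exp (A.z i)) : A.Generic (thetaSigma p) N := by
  have sigma_ne_zero {u v w : ℂ} (m : ℤ) (hv : ellTheta p (v * Complex.exp A.h ^ m) ≠ 0)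
      (hw : Complex.exp w = v) (hu : u = w + m * A.h) : thetaSigma p u ≠ 0 := by
    rwa [ne_eq, thetaSigma_eq_zero_iff, hu, Complex.exp_add, Complex.exp_int_mul, hw]
  constructor
  case sub => exact fun i j hij l hl =>
    sigma_ne_zero l (hsub i j hij l hl) (Complex.exp_sub _ _) rfl
  case nat =>
    intro l hl hlN
    rw [ne_eq, thetaSigma_eq_zero_iff, Complex.exp_nat_mul]
    exact hnat l hl hlN
  case alpha =>
    intro l
    refine sigma_ne_zero _ (hgen.alpha (N + l)) rfl ?_
    push_cast
    ring
  case eps_sub =>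
    intro i l
    refine sigma_ne_zero _ (hgen.eps_div i (N + l)) (Complex.exp_sub _ _) ?_
    push_cast
    ring
  case pole_sub =>
    intro i l
    refine sigma_ne_zero l (hgen.pole_div i l)
      (w := A.ε - N * A.h - (A.α - N * A.h + A.z i)) ?_ (by ring)
    rw [Complex.exp_sub, Complex.exp_add]
  case pole_add =>
    intro i l
    refine sigma_ne_zero l (hgen.pole_mul i l)
      (w := A.ε - N * A.h + A.z i - (A.α - N * A.h)) ?_ (by ring)
    rw [Complex.exp_sub, Complex.exp_add]
  case parity =>
    intro i l
    obtain ⟨m, hm⟩ := hA.exists_exp_r_eq N i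
    rw [ne_eq, thetaSigma_eq_zero_iff, Complex.exp_add, Complex.exp_int_mul, hm, mul_assoc,
      ← zpow_add₀ (Complex.exp_ne_zero _)]
    exact hgen.parity i (m + l)

end JacksonParams

theorem sum_jacksonSummand_of_generic {p q : ℂ} (hp : ‖p‖ < 1) (hq : q ≠ 0) {n N : ℕ}
    {a b c d e : ℂ} {z : Fin n → ℂ} (ha : a ≠ 0) (hb : b ≠ 0) (hc : c ≠ 0) (he : e ≠ 0)
    (hz : ∀ i, z i ≠ 0) (hbal : a ^ 2 * q ^ (N + 1) = b * c * d * e * ∏ i, z i ^ 2)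
    (hsub : ∀ i j, i ≠ j → ∀ l : ℤ, |l| ≤ N → ellTheta p (z i / z j * q ^ l) ≠ 0)
    (hnat : ∀ l : ℕ, 1 ≤ l → l ≤ N → ellTheta p (q ^ l) ≠ 0)
    (hgen : ThetaGeneric p q a b c d e z) :
    ∑ x ∈ indexSimplex n N, jacksonSummand p q a b c d e z N x =
      jacksonValue p q a b c d e z N := by
  obtain ⟨A, hA, rfl, rfl, rfl, rfl, rfl, rfl, rfl⟩ :=
    JacksonParams.exists_exp_eq hq ha hb hc he hz hbal
  have hσ := isSigma_thetaSigma hp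
  calc _ = ∑ x ∈ indexSimplex n N, A.summand (thetaSigma p) N x :=
        sum_congr rfl fun x _ => JacksonParams.jacksonSummand_exp p hA N x
    _ = ∏ j ∈ range N, A.valueRatio (thetaSigma p) j :=
        JacksonParams.sum_summand_eq hσ (hA.generic hsub hnat hgen) (hA.balanced hσ) le_rfl
    _ = _ := (JacksonParams.jacksonValue_exp hp hA N).symm

/-! ### Continuity and deformation of the parameters -/

section Continuity

variable {p q b c d t : ℂ} {n N : ℕ} {z : Fin n → ℂ} {a e : ℂ → ℂ}

theorem continuousAt_ellTheta_comp (hp : ‖p‖ < 1) {f : ℂ → ℂ} (hf : ContinuousAt f t)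
    (hft : f t ≠ 0) : ContinuousAt (fun u => ellTheta p (f u)) t :=
  ContinuousAt.comp (g := ellTheta p) (continuousAt_ellTheta hp hft) hf

theorem continuousAt_ellPoch_comp (hp : ‖p‖ < 1) (hq : q ≠ 0) {f : ℂ → ℂ}
    (hf : ContinuousAt f t) (hft : f t ≠ 0) (k : ℕ) :
    ContinuousAt (fun u => ellPoch p q (f u) k) t :=
  tendsto_finsetProd _ fun j _ => continuousAt_ellTheta_comp hp (continuousAt_const.mul hf)
    (mul_ne_zero (pow_ne_zero j hq) hft)

theorem continuousAt_paritySummandFactor (hp : ‖p‖ < 1) (hq : q ≠ 0) (ha : ContinuousAt a t)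
    (he : ContinuousAt e t) (hat : a t ≠ 0) (hb : b ≠ 0) (hc : c ≠ 0) (hd : d ≠ 0)
    (het : e t ≠ 0) (hZ : ∏ i, z i ≠ 0)
    (hden : JacksonDenominatorsNeZero p q (a t) b c d (e t) z N) {k : ℕ} (hk : k ≤ N) :
    ContinuousAt (fun u => paritySummandFactor p q (a u) b c d (e u) (∏ i, z i) n N k) t := by
  simp only [paritySummandFactor]
  split_ifs with hn
  · obtain ⟨eZ_ne, bZ_ne, cZ_ne, dZ_ne⟩ := hden.odd_summand hn k hk
    refine continuousAt_const.div (((ContinuousAt.mul ?_ ?_).mul ?_).mul ?_)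
      (mul_ne_zero (mul_ne_zero (mul_ne_zero eZ_ne bZ_ne) cZ_ne) dZ_ne) <;>
    refine continuousAt_ellPoch_comp hp hq ?_ (by simp [*]) k <;>
    refine ContinuousAt.div₀ (by fun_prop) (by fun_prop) (by simp [*])
  · obtain ⟨Z_ne, bcZ_ne, bdZ_ne, cdZ_ne⟩ := hden.even_summand (Nat.not_odd_iff_even.1 hn) k hk
    refine continuousAt_const.div (((ContinuousAt.mul ?_ ?_).mul ?_).mul ?_)
      (mul_ne_zero (mul_ne_zero (mul_ne_zero Z_ne bcZ_ne) bdZ_ne) cdZ_ne) <;>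
    refine continuousAt_ellPoch_comp hp hq ?_ (by simp [*]) k <;>
    refine ContinuousAt.div₀ (by fun_prop) (by fun_prop) (by simp [*])

theorem continuousAt_parityValueFactor (hp : ‖p‖ < 1) (hq : q ≠ 0) (ha : ContinuousAt a t)
    (he : ContinuousAt e t) (hat : a t ≠ 0) (hb : b ≠ 0) (hc : c ≠ 0) (hd : d ≠ 0)
    (het : e t ≠ 0) (hZ : ∏ i, z i ≠ 0)
    (hden : JacksonDenominatorsNeZero p q (a t) b c d (e t) z N) :
    ContinuousAt (fun u => parityValueFactor p q (a u) b c d (e u) (∏ i, z i) n N) t := by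
  simp only [parityValueFactor]
  split_ifs with hn
  · obtain ⟨-, bZ_ne, cZ_ne, dZ_ne⟩ := hden.odd_summand hn N le_rfl
    refine (he.pow N).div (((ContinuousAt.mul ?_ ?_).mul ?_).mul ?_)
      (mul_ne_zero (mul_ne_zero (mul_ne_zero bZ_ne cZ_ne) dZ_ne) (hden.odd_value hn)) <;>
    refine continuousAt_ellPoch_comp hp hq ?_ (by simp [*]) N <;>
    refine ContinuousAt.div₀ (by fun_prop) (by fun_prop) (by simp [*])
  · obtain ⟨Z_ne, -⟩ := hden.even_summand (Nat.not_odd_iff_even.1 hn) N le_rfl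
    obtain ⟨beZ_ne, ceZ_ne, deZ_ne⟩ := hden.even_value (Nat.not_odd_iff_even.1 hn)
    refine continuousAt_const.div (((ContinuousAt.mul ?_ ?_).mul ?_).mul ?_)
      (mul_ne_zero (mul_ne_zero (mul_ne_zero Z_ne beZ_ne) ceZ_ne) deZ_ne) <;>
    refine continuousAt_ellPoch_comp hp hq ?_ (by simp [*]) N <;>
    refine ContinuousAt.div₀ (by fun_prop) (by fun_prop) (by simp [*])

theorem continuousAt_jacksonValue (hp : ‖p‖ < 1) (hq : q ≠ 0) (ha : ContinuousAt a t)
    (he : ContinuousAt e t) (hat : a t ≠ 0) (hb : b ≠ 0) (hc : c ≠ 0) (hd : d ≠ 0)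
    (het : e t ≠ 0) (hz : ∀ i, z i ≠ 0)
    (hden : JacksonDenominatorsNeZero p q (a t) b c d (e t) z N) :
    ContinuousAt (fun u => jacksonValue p q (a u) b c d (e u) z N) t := by
  have hZ : ∏ i, z i ≠ 0 := prod_ne_zero_iff.2 fun i _ => hz i
  refine ContinuousAt.mul (ContinuousAt.div₀ ?_ ?_ ?_)
    (continuousAt_parityValueFactor hp hq ha he hat hb hc hd het hZ hden)
  · refine ((((continuousAt_ellPoch_comp hp hq (by fun_prop) (by simp [*]) N).mul ?_).mul ?_).mul
      ?_).mul (tendsto_finsetProd _ fun i _ => ?_) <;>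
    refine continuousAt_ellPoch_comp hp hq ?_ (by simp [*]) N <;>
    refine ContinuousAt.div₀ (by fun_prop) (by fun_prop) (by simp [*])
  · refine continuousAt_const.mul (tendsto_finsetProd _ fun i _ => ?_)
    refine continuousAt_ellPoch_comp hp hq ?_ (by simp [*]) N
    exact ContinuousAt.div₀ (by fun_prop) (by fun_prop) het
  · exact mul_ne_zero (pow_ne_zero N hZ) (prod_ne_zero_iff.2 fun i _ => hden.aq_div_e i N le_rfl)

theorem continuousAt_jacksonSummand (hp : ‖p‖ < 1) (hq : q ≠ 0) (ha : ContinuousAt a t)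
    (he : ContinuousAt e t) (hat : a t ≠ 0) (hb : b ≠ 0) (hc : c ≠ 0) (hd : d ≠ 0)
    (het : e t ≠ 0) (hz : ∀ i, z i ≠ 0)
    (hden : JacksonDenominatorsNeZero p q (a t) b c d (e t) z N) {x : Fin n → ℕ}
    (hx : x ∈ indexSimplex n N) :
    ContinuousAt (fun u => jacksonSummand p q (a u) b c d (e u) z N x) t := by
  have hZ : ∏ i, z i ≠ 0 := prod_ne_zero_iff.2 fun i _ => hz i
  have sum_le : ∑ i, x i ≤ N := mem_indexSimplex.1 hx
  have le_N (i : Fin n) : x i ≤ N := (JacksonParams.le_sum x i).trans sum_le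
  refine (((((continuousAt_const.mul ?_).mul ?_).mul ?_).mul continuousAt_const).mul ?_).mul
    (continuousAt_paritySummandFactor hp hq ha he hat hb hc hd het hZ hden sum_le)
  · refine ContinuousAt.div₀ ?_ (continuousAt_ellTheta_comp hp ha hat) hden.theta_a
    exact continuousAt_ellTheta_comp hp (by fun_prop) (by simp [*])
  · refine continuousAt_const.div (tendsto_finsetProd _ fun i _ => ?_)
      (prod_ne_zero_iff.2 fun i _ => hden.e_div x hx i)
    exact continuousAt_ellPoch_comp hp hq (he.div_const _) (by simp [*]) _
  · refine ContinuousAt.div₀ (((continuousAt_ellPoch_comp hp hq ha hat _).mul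
      continuousAt_const).mul (tendsto_finsetProd _ fun i _ => ?_)) ?_ (hden.aq_pow _ sum_le)
    · exact continuousAt_ellPoch_comp hp hq (he.div_const _) (by simp [*]) _
    · exact continuousAt_ellPoch_comp hp hq (by fun_prop) (by simp [*]) _
  · refine tendsto_finsetProd _ fun i _ => ContinuousAt.div₀ (continuousAt_const.mul ?_)
      (ContinuousAt.mul ?_ continuousAt_const) (mul_ne_zero (hden.aq_div_e i _ (le_N i))
      (prod_ne_zero_iff.2 fun j _ => hden.q_div i j _ (le_N i))) <;>
    refine continuousAt_ellPoch_comp hp hq ?_ (by simp [*]) _ <;>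
    refine ContinuousAt.div₀ (by fun_prop) (by fun_prop) (by simp [*])

end Continuity

section Deformation

open Filter Topology

theorem tendsto_cocountable_of_countable_preimage {X Y : Type*} {f : X → Y}
    (hf : ∀ y, (f ⁻¹' {y}).Countable) : Tendsto f cocountable cocountable := by
  intro s hs
  rw [Filter.mem_map, mem_cocountable, ← Set.preimage_compl, ← Set.biUnion_preimage_singleton]
  exact (mem_cocountable.1 hs).biUnion fun y _ => hf y

theorem tendsto_const_mul_pow_cocountable {F : Type*} [Field F] {C : F} (hC : C ≠ 0) {k : ℕ}
    (hk : k ≠ 0) : Tendsto (fun t => C * t ^ k) cocountable cocountable := by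
  classical
  refine tendsto_cocountable_of_countable_preimage fun y =>
    ((Polynomial.nthRoots k (y / C)).toFinset.countable_toSet).mono fun t ht => ?_
  rw [mem_coe, Multiset.mem_toFinset, Polynomial.mem_nthRoots hk.pos, eq_div_iff hC, mul_comm]
  exact ht

theorem eq_of_continuousAt_of_eventuallyEq_cocountable {F Y : Type*} [NontriviallyNormedField F]
    [CompleteSpace F] [TopologicalSpace Y] [T2Space Y] {f g : F → Y} {t : F}
    (hf : ContinuousAt f t) (hg : ContinuousAt g t) (hfg : f =ᶠ[cocountable] g) : f t = g t := by
  refine tendsto_nhds_unique_of_frequently_eq hf hg (mem_closure_iff_frequently.1 ?_)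
  have hdense := (mem_cocountable.1 hfg).dense_compl F
  rw [compl_compl] at hdense
  exact hdense t

theorem eventually_ellTheta_ne_zero {p : ℂ} (hp : ‖p‖ < 1) :
    ∀ᶠ z in cocountable, ellTheta p z ≠ 0 := by
  rw [Filter.Eventually, mem_cocountable]
  refine ((Set.countable_range fun m : ℤ => p ^ m).insert 0).mono fun z hz => ?_
  rw [Set.mem_compl_iff, Set.mem_ofPred_eq, not_not] at hz
  refine or_iff_not_imp_left.2 fun hz0 => ?_
  exact ((ellTheta_eq_zero_iff hp hz0).1 hz).imp fun _ => Eq.symm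

theorem parityRatios_mul (n : ℕ) {a b c d e Z t : ℂ} (ht : t ≠ 0) (i : Fin 4) :
    parityRatios n (a * t) b c d (e * t ^ 2) Z i = parityRatios n a b c d e Z i * t := by
  simp only [parityRatios]
  split_ifs <;> fin_cases i <;> simp only [Fin.reduceFinMk, Matrix.cons_val] <;> field_simp

theorem eventually_thetaGeneric {p q : ℂ} (hp : ‖p‖ < 1) (hq : q ≠ 0) {n : ℕ} {a b c d e : ℂ}
    {z : Fin n → ℂ} (ha : a ≠ 0) (hb : b ≠ 0) (hc : c ≠ 0) (hd : d ≠ 0) (he : e ≠ 0)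
    (hz : ∀ i, z i ≠ 0) :
    ∀ᶠ t in cocountable, ThetaGeneric p q (a * t) b c d (e * t ^ 2) z := by
  have hZ : ∏ i, z i ≠ 0 := prod_ne_zero_iff.2 fun i _ => hz i
  have : CountableInterFilter (cocountable : Filter ℂ) := cardinalInterFilter_aleph_one_iff.1
    inferInstance
  have zpow_family {k : ℕ} (hk : k ≠ 0) {C : ℂ} (hC : C ≠ 0) :
      ∀ᶠ t in cocountable, ∀ l : ℤ, ellTheta p (C * q ^ l * t ^ k) ≠ 0 :=
    eventually_countable_forall.2 fun l =>
      (tendsto_const_mul_pow_cocountable (mul_ne_zero hC (zpow_ne_zero l hq)) hk).eventually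
        (eventually_ellTheta_ne_zero hp)
  filter_upwards [eventually_cocardinal_ne 0, zpow_family one_ne_zero ha,
    eventually_countable_forall.2 fun i => zpow_family two_ne_zero (div_ne_zero he (hz i)),
    eventually_countable_forall.2 fun i =>
      zpow_family one_ne_zero (div_ne_zero he (mul_ne_zero ha (hz i))),
    eventually_countable_forall.2 fun i =>
      zpow_family one_ne_zero (div_ne_zero (mul_ne_zero he (hz i)) ha),
    eventually_countable_forall.2 fun i =>
      zpow_family one_ne_zero (parityRatios_ne_zero ha hb hc hd he hZ i)]
    with t ht alpha eps_div pole_div pole_mul parity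
  refine ⟨fun l => ?_, fun i l => ?_, fun i l => ?_, fun i l => ?_, fun i l => ?_⟩
  · convert alpha l using 2
    ring
  · convert eps_div i l using 2
    ring
  · convert pole_div i l using 2
    have := hz i
    field_simp
  · convert pole_mul i l using 2
    field_simp
  · convert parity i l using 2
    rw [parityRatios_mul n ht]
    ring

end Deformation

namespace JacksonDenominatorsNeZero

variable {p q a b c d e : ℂ} {n N : ℕ} {z : Fin n → ℂ}

theorem ellTheta_pow_succ_mul_div_ne_zero (hden : JacksonDenominatorsNeZero p q a b c d e z N)
    (i j : Fin n) {m : ℕ} (hm : m < N) : ellTheta p (z i / z j * q ^ (m + 1)) ≠ 0 := by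
  have := prod_ne_zero_iff.1 (hden.q_div i j N le_rfl) m (mem_range.2 hm)
  rwa [show z i / z j * q ^ (m + 1) = q ^ m * (q * z i / z j) by ring]

theorem ellTheta_pow_ne_zero (hden : JacksonDenominatorsNeZero p q a b c d e z N) (i : Fin n)
    (hz : z i ≠ 0) {l : ℕ} (hl : 1 ≤ l) (hlN : l ≤ N) : ellTheta p (q ^ l) ≠ 0 := by
  obtain ⟨m, rfl⟩ := Nat.exists_eq_add_of_le' hl
  simpa only [div_self hz, one_mul] using hden.ellTheta_pow_succ_mul_div_ne_zero i i hlN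

theorem ellTheta_div_mul_zpow_ne_zero (hden : JacksonDenominatorsNeZero p q a b c d e z N)
    (hp : ‖p‖ < 1) (hq : q ≠ 0) (hz : ∀ i, z i ≠ 0) {i j : Fin n} (hij : i ≠ j) {l : ℤ}
    (hl : |l| ≤ N) : ellTheta p (z i / z j * q ^ l) ≠ 0 := by
  rw [abs_le] at hl
  obtain (_ | m) | m := l
  · rw [Int.ofNat_eq_natCast, Nat.cast_zero, zpow_zero, mul_one]
    rcases lt_or_gt_of_ne hij with hij | hji
    · rw [← inv_div]
      exact ellTheta_inv_ne_zero hp (div_ne_zero (hz j) (hz i)) (hden.delta i j hij)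
    · exact hden.delta j i hji
  · rw [Int.ofNat_eq_natCast] at hl ⊢
    rw [zpow_natCast]
    exact hden.ellTheta_pow_succ_mul_div_ne_zero i j (by omega)
  · rw [zpow_negSucc, ← inv_div, ← mul_inv]
    exact ellTheta_inv_ne_zero hp
      (mul_ne_zero (div_ne_zero (hz j) (hz i)) (pow_ne_zero _ hq))
      (hden.ellTheta_pow_succ_mul_div_ne_zero j i (by omega))

end JacksonDenominatorsNeZero

theorem sum_jacksonSummand_fin_zero {p q a b c d e : ℂ} {z : Fin 0 → ℂ} {N : ℕ}
    (hden : JacksonDenominatorsNeZero p q a b c d e z N) :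
    ∑ x ∈ indexSimplex 0 N, jacksonSummand p q a b c d e z N x =
      jacksonValue p q a b c d e z N := by
  have indexSimplex_eq : indexSimplex 0 N = {0} := by
    ext x
    simp [mem_indexSimplex, Subsingleton.elim x 0]
  obtain ⟨Z_ne, -⟩ := hden.even_summand ⟨0, rfl⟩ N le_rfl
  obtain ⟨beZ_ne, ceZ_ne, deZ_ne⟩ := hden.even_value ⟨0, rfl⟩
  simp only [univ_eq_empty, prod_empty, mul_one, div_one] at Z_ne beZ_ne ceZ_ne deZ_ne
  rw [indexSimplex_eq, sum_singleton]
  have summand_eq : jacksonSummand p q a b c d e z N 0 = 1 := by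
    simp [jacksonSummand, paritySummandFactor, ellDelta, ellPoch, hden.theta_a]
  have value_eq : jacksonValue p q a b c d e z N = 1 := by
    simp only [jacksonValue, parityValueFactor, univ_eq_empty, prod_empty, one_pow, mul_one,
      div_one, Nat.not_odd_zero, if_false]
    exact mul_one_div_cancel
      (mul_ne_zero (mul_ne_zero (mul_ne_zero Z_ne beZ_ne) ceZ_ne) deZ_ne)
  rw [summand_eq, value_eq]

theorem corollary4p3 (p q : ℂ) (hp : ‖p‖ < 1) (hq : q ≠ 0) (n N : ℕ)
    (a b c d e : ℂ) (z : Fin n → ℂ)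
    (ha : a ≠ 0) (hb : b ≠ 0) (hc : c ≠ 0) (hd : d ≠ 0) (he : e ≠ 0) (hz : ∀ i, z i ≠ 0)
    (hbal : a ^ 2 * q ^ (N + 1) = b * c * d * e * ∏ i, z i ^ 2)
    (hden : JacksonDenominatorsNeZero p q a b c d e z N) :
    ∑ x ∈ indexSimplex n N, jacksonSummand p q a b c d e z N x =
      jacksonValue p q a b c d e z N := by
  rcases n with _ | n
  · exact sum_jacksonSummand_fin_zero hden
  -- The deformation `a ↦ a t`, `e ↦ e t ^ 2` preserves the balancing condition.
  have sum_continuousAt : ContinuousAt (fun t => ∑ x ∈ indexSimplex (n + 1) N,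
      jacksonSummand p q (a * t) b c d (e * t ^ 2) z N x) 1 :=
    tendsto_finsetSum _ fun x hx => continuousAt_jacksonSummand hp hq (by fun_prop)
      (by fun_prop) (by simpa) hb hc hd (by simpa) hz (by simpa) hx
  have value_continuousAt :
      ContinuousAt (fun t => jacksonValue p q (a * t) b c d (e * t ^ 2) z N) 1 :=
    continuousAt_jacksonValue hp hq (by fun_prop) (by fun_prop) (by simpa) hb hc hd (by simpa) hz
      (by simpa)
  have sum_eq_value := eq_of_continuousAt_of_eventuallyEq_cocountable sum_continuousAt
    value_continuousAt ?_
  · simpa only [mul_one, one_pow] using sum_eq_value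
  filter_upwards [Filter.eventually_cocardinal_ne 0,
    eventually_thetaGeneric hp hq ha hb hc hd he hz] with t ht hgen
  exact sum_jacksonSummand_of_generic hp hq (mul_ne_zero ha ht) hb hc
    (mul_ne_zero he (pow_ne_zero 2 ht)) hz (by linear_combination t ^ 2 * hbal)
    (fun i j hij l hl => hden.ellTheta_div_mul_zpow_ne_zero hp hq hz hij hl)
    (fun l hl hlN => hden.ellTheta_pow_ne_zero 0 (hz 0) hl hlN) hgen
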